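/- **Setting.** Let $K$ be a totally ordered set of keys and add sentinels $-\infty<k<\infty$ for all $k\in K$. Asynchronous processes perform operations $\mathrm{Get}(key)$, $\mathrm{Insert}(key,count)$ and $\mathrm{Delete}(key,count)$ with $key\in K$, $count\ge 1$, on a singly linked list of nodes. A node has an immutable field $key$ and mutable fields $count$, $next$. Initially, $head$ has key $-\infty$, count $0$ and points to $tail$, which has key $\infty$, count $0$ and $next=\mathrm{Nil}$. New nodes get unused addresses. A node is *in the data structure* if it can be reached from $head$ by following $next$ pointers. **Primitives.** Nodes are accessed by atomic reads and by the primitives $\mathrm{LLX}(r)$ and $\mathrm{SCX}(V,R,fld,new)$ ($R$ a subsequence of $V$, $fld$ a mutable field of a node in $V$), as specified by the following correctness conditions. Some invocations are linearized: every LLX that does not return Fail, every SCX that returns True, possibly some SCXs that have not terminated, and no other ones. Linearized SCXs store $new$ in $fld$. Reads, and linearized LLXs that do not return Finalized, return the last values stored by the SCXs linearized before (or the initial values). A linearized $\mathrm{LLX}(r)$ returns Finalized if and only if an SCX with $r$ in $R$ was linearized before it. If an $\mathrm{SCX}(V,R,fld,new)$ is linearized then, for each $r$ in $V$, no SCX whose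 first argument contains $r$ is linearized between the $\mathrm{LLX}(r)$ linked to it (the last $\mathrm{LLX}(r)$ of the same process, if that returned a snapshot and the process has not used it for an SCX since) and itself. LLXs may return Fail and SCXs may return False at any time without being linearized. **Algorithm.** $\mathrm{Search}(key)$: $p:=head$; $r:=p.next$; while $key>r.key$ do ($p:=r$; $r:=r.next$); return $\langle r,p\rangle$. $\mathrm{Get}(key)$: $\langle r,p\rangle:=\mathrm{Search}(key)$; return $r.count$ if $key=r.key$, else $0$. $\mathrm{Insert}(key,count)$: repeat: $\langle r,p\rangle:=\mathrm{Search}(key)$. If $key=r.key$: $localr:=\mathrm{LLX}(r)$; if this is a snapshot and $\mathrm{SCX}(\langle r\rangle,\langle\rangle,r.count,localr.count+count)$ returns True, return. Otherwise: $localp:=\mathrm{LLX}(p)$; if this is a snapshot, $r=localp.next$, and $\mathrm{SCX}(\langle p\rangle,\langle\rangle,p.next,\text{new Node}(key,count,r))$ returns True, return. $\mathrm{Delete}(key,count)$: repeat: $\langle r,p\rangle:=\mathrm{Search}(key)$; $localp:=\mathrm{LLX}(p)$; $localr:=\mathrm{LLX}(r)$. If both are snapshots and $r=localp.next$: if $key\ne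 r.key$ or $localr.count<count$, return False; else if $localr.count>count$, return True if $\mathrm{SCX}(\langle p,r\rangle,\langle r\rangle,p.next,\text{new Node}(r.key,localr.count-count,localr.next))$ returns True; else let $rnext=localr.next$; if $\mathrm{LLX}(rnext)$ returns a snapshot and $\mathrm{SCX}(\langle p,r,rnext\rangle,\langle r,rnext\rangle,p.next,\text{new copy of }rnext)$ returns True, return True. **Linearization points.** An Insert or Delete that performs a linearized SCX is linearized at that SCX. A Get, or a Delete that returns False, that sees $r.key\ne key$ is linearized at the last time during its last Search when $p$ is in the data structure and $p.next=r$. A Get that sees $r.key=key$, or a Delete that returns False after seeing $r.key=key$ and $localr.count<count$, is linearized at the last time after the start of its last Search and at or before its read (respectively, its $\mathrm{LLX}(r)$) that obtained the value $v$ of $r.count$, when $r$ is in the data structure and $r.count=v$. **Lemma.** In every (finite or infinite) execution of this algorithm, these linearization points are well defined: no operation has two of them, and every operation that returns has one, between its invocation and its response. At every time $t$, only finitely many operations have been linearized, and the multiset of keys in the data structure is equal to the multiset of keys that results from the atomic execution, starting with the empty multiset, of the sequence of operations linearized up to time $t$ (in the order of their linearization points, ties being broken arbitrarily). Here the number of occurrences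 of $key\in K$ in the data structure is $r.count$ if there is a node $r$ in the data structure with $r.key=key$ (and this is well defined), and $0$ otherwise. Executed atomically, $\mathrm{Insert}(key,count)$ adds $count$ copies of $key$, $\mathrm{Delete}(key,count)$ removes $count$ copies of $key$ if there are at least $count$ of them and changes nothing otherwise, and $\mathrm{Get}$ changes nothing. -/

import Mathlib

namespace LLXMultiset

/-! ### The abstract multiset -/

/-- The operations of the multiset type. -/
inductive Op (K : Type*) where
  | get (key : K)
  | insert (key : K) (count : ℕ)
  | delete (key : K) (count : ℕ)

/-- The preconditions of the operations: `count > 0` for Insert and Delete. -/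
def Op.Valid {K : Type*} : Op K → Prop
  | .get _ => True
  | .insert _ c => 0 < c
  | .delete _ c => 0 < c

def Op.key {K : Type*} : Op K → K
  | .get k => k
  | .insert k _ => k
  | .delete k _ => k

/-- The multiset after the atomic execution of an operation on the multiset `σ`. -/
def Op.exec {K : Type*} [LinearOrder K] (σ : Multiset K) : Op K → Multiset K
  | .get _ => σ
  | .insert k c => σ + Multiset.replicate c k
  | .delete k c => if c ≤ σ.count k then σ - Multiset.replicate c k else σ

/-- The multiset after the atomic execution of a sequence of operations, starting from the
empty multiset. -/
def atomicExec {K : Type*} [LinearOrder K] (l : List (Op K)) : Multiset K :=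
  l.foldl Op.exec 0

/-- Responses of operations. -/
inductive Resp where
  | num (n : ℕ)
  | done
  | bool (b : Bool)

/-! ### Data-records, LLX and SCX -/

/-- Addresses of Data-records. -/
abbrev Addr := ℕ

/-- Node keys: keys of the multiset together with `-∞` and `∞`. -/
abbrev EKey (K : Type*) := WithBot (WithTop K)

/-- A key of the multiset as a node key. -/
def ekey {K : Type*} (k : K) : EKey K := ((k : WithTop K) : WithBot (WithTop K))

/-- The Data-record of a list node: `key` is immutable, `count` and `next` are mutable;
`next = none` is Nil. -/
structure Node (K : Type*) where
  key : EKey K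
  count : ℕ
  next : Option Addr

def head : Addr := 0

def tail : Addr := 1

/-- The pair `fld`, `new` of an SCX: a mutable field of a Data-record and the value to be stored
in it. -/
inductive Update where
  | count (r : Addr) (new : ℕ)
  | next (r : Addr) (new : Addr)

/-- The arguments of an invocation of `SCX(V, R, fld, new)`. -/
structure Scx where
  V : List Addr
  R : List Addr
  upd : Update

/-- Storing the value of an update in its field. -/
def Update.apply {K : Type*} (h : Addr → Option (Node K)) : Update → Addr → Option (Node K)
  | .count r v => Function.update h r ((h r).map fun nd => { nd with count := v })
  | .next r a => Function.update h r ((h r).map fun nd => { nd with next := some a })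

/-- The value returned by an LLX: Fail, Finalized or a snapshot of the mutable fields. -/
inductive LlxResult where
  | fail
  | finalized
  | snap (count : ℕ) (next : Option Addr)

/-- The local state (program counter and local variables) of a process. -/
inductive Local (K : Type*) where
  /-- no operation is in progress -/
  | idle
  /-- about to call `Search(key)` (for Insert and Delete: at the top of the while loop) -/
  | loop (o : Op K)
  /-- at the loop test of `Search` with local variables `p` and `r` -/
  | search (o : Op K) (p r : Addr)
  /-- `Search` has returned `⟨r, p⟩` -/
  | found (o : Op K) (p r : Addr)
  /-- Insert, case `key = r.key`, after `localr := LLX(r)` -/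
  | insR (k : K) (c : ℕ) (r : Addr) (lr : LlxResult)
  /-- Insert, case `key ≠ r.key`, after `localp := LLX(p)` -/
  | insP (k : K) (c : ℕ) (p r : Addr) (lp : LlxResult)
  /-- Delete, after `localp := LLX(p)` -/
  | delP (k : K) (c : ℕ) (p r : Addr) (lp : LlxResult)
  /-- Delete, after `localr := LLX(r)` -/
  | delPR (k : K) (c : ℕ) (p r : Addr) (lp lr : LlxResult)
  /-- Delete, case `localr.count = count`, after `LLX(rnext)`, where `rnext = localr.next` -/
  | delNext (k : K) (c : ℕ) (p r rnext : Addr) (ln : LlxResult)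
  /-- an SCX has been invoked and is neither linearized nor terminated; `link r` is the position of
  the linked `LLX(r)` -/
  | scx (o : Op K) (S : Scx) (link : Addr → Option ℕ)
  /-- the SCX has been linearized but has not returned yet -/
  | scxDone (o : Op K)

/-- A configuration.
* `heap` holds the Data-records created so far (with their current field values);
* `hist` is the sequence of SCXs linearized so far;
* `loc q` is the local state of the process `q`;
* `link q r = some n` if an `LLX(r)` by `q` returned a snapshot, it was linearized when exactly `n`
  SCXs had been linearized, and `q` has since invoked neither `LLX(r)` nor an SCX whose `V` contains
  `r`; this is the LLX that is linked to the next SCX of `q` if `r` is in `V`. -/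
structure Config (P K : Type*) where
  heap : Addr → Option (Node K)
  hist : List Scx
  loc : P → Local K
  link : P → Addr → Option ℕ

/-- The initial configuration: `head` (key `-∞`) points to `tail` (key `∞`), both with count 0. -/
def Config.initial (P K : Type*) : Config P K where
  heap := fun a =>
    if a = head then some ⟨⊥, 0, some tail⟩ else if a = tail then some ⟨⊤, 0, none⟩ else none
  hist := []
  loc := fun _ => .idle
  link := fun _ _ => none

/-- `r` is a Data-record whose `next` pointer points to `r'`. -/
def Config.PointsTo {P K : Type*} (C : Config P K) (r r' : Addr) : Prop :=
  ∃ nd, C.heap r = some nd ∧ nd.next = some r'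

/-- `r` is in the data structure: it is reachable from the entry point `head`. -/
def Config.InDS {P K : Type*} (C : Config P K) (r : Addr) : Prop :=
  Relation.ReflTransGen C.PointsTo head r

def Config.HasKey {P K : Type*} (C : Config P K) (r : Addr) (x : EKey K) : Prop :=
  ∃ nd, C.heap r = some nd ∧ nd.key = x

def Config.HasCount {P K : Type*} (C : Config P K) (r : Addr) (n : ℕ) : Prop :=
  ∃ nd, C.heap r = some nd ∧ nd.count = n

/-- Some linearized `SCX(V, R, fld, new)` has `r` in `R`. -/
def Config.Finalized {P K : Type*} (C : Config P K) (r : Addr) : Prop :=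
  ∃ S ∈ C.hist, r ∈ S.R

/-- `res` is a possible result of an `LLX(r)` linearized in `C`, or Fail (such an LLX is not
linearized and may occur at any time). A linearized LLX returns Finalized if and only if an SCX with
`r` in `R` was linearized before it, and otherwise the current values of the mutable fields. -/
def Config.LlxReturns {P K : Type*} (C : Config P K) (r : Addr) : LlxResult → Prop
  | .fail => True
  | .finalized => C.Finalized r
  | .snap c n => ¬ C.Finalized r ∧ ∃ nd, C.heap r = some nd ∧ nd.count = c ∧ nd.next = n

/-- No SCX that depends on a Data-record `r` in `S.V` has been linearized since the `LLX(r)` linked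
to `S`. -/
def Config.Unchanged {P K : Type*} (C : Config P K) (S : Scx) (link : Addr → Option ℕ) : Prop :=
  ∀ r ∈ S.V, ∀ n, link r = some n → ∀ S' ∈ C.hist.drop n, r ∉ S'.V

/-- The number of occurrences of `k` in the data structure is `n`: `n` is the count of a node in the
data structure with key `k`, or `n = 0` if there is no such node. -/
def Config.Occurs {P K : Type*} (C : Config P K) (k : K) (n : ℕ) : Prop :=
  (∃ r, C.InDS r ∧ C.HasKey r (ekey k) ∧ C.HasCount r n) ∨
    ((¬ ∃ r, C.InDS r ∧ C.HasKey r (ekey k)) ∧ n = 0)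

/-- `σ` is the multiset of keys in the data structure: for every key, the number of occurrences in
the data structure is well defined and equal to the multiplicity in `σ`. -/
def Config.IsKeyMultiset {P K : Type*} [LinearOrder K] (C : Config P K) (σ : Multiset K) : Prop :=
  ∀ k n, C.Occurs k n ↔ n = σ.count k

section Steps

variable {P K : Type*} [DecidableEq P]

/-- Changing the local state of a process. -/
def Config.goto (C : Config P K) (q : P) (s : Local K) : Config P K :=
  { C with loc := Function.update C.loc q s }

/-- The configuration after process `q` performs `LLX(r)` with result `res` and continues in local
state `s`. -/
def Config.llx (C : Config P K) (q : P) (r : Addr) (res : LlxResult) (s : Local K) :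
    Config P K :=
  { C with
    loc := Function.update C.loc q s
    link := Function.update C.link q (Function.update (C.link q) r
      (match res with
        | .snap _ _ => some C.hist.length
        | _ => none)) }

/-- The configuration after process `q` invokes the SCX `S` on behalf of operation `o`. -/
def Config.invokeScx (C : Config P K) (q : P) (o : Op K) (S : Scx) : Config P K :=
  { C with
    loc := Function.update C.loc q (.scx o S (C.link q))
    link := Function.update C.link q (fun r => if r ∈ S.V then none else C.link q r) }

/-- Creating a new node at address `a`. -/
def Config.alloc (C : Config P K) (a : Addr) (nd : Node K) : Config P K :=
  { C with heap := Function.update C.heap a (some nd) }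

/-- The configuration after the SCX `S` of process `q` is linearized. -/
def Config.linearizeScx (C : Config P K) (q : P) (o : Op K) (S : Scx) : Config P K :=
  { C with
    heap := S.upd.apply C.heap
    hist := C.hist ++ [S]
    loc := Function.update C.loc q (.scxDone o) }

end Steps

/-- Labels of steps. -/
inductive Action (K : Type*) where
  | invoke (o : Op K)
  | searchBegin
  | searchAdvance
  | searchReturn
  | llx (r : Addr)
  | scxInvoke
  | scxLinearize
  | scxFalse
  | restart
  | ret (v : Resp)

/-- `Step C q a C'`: in configuration `C`, process `q` can perform a step `a` of the multiset
algorithm, which leads to `C'`. A process that would have to dereference Nil can take no step. -/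
inductive Step {P K : Type*} [DecidableEq P] [LinearOrder K] :
    Config P K → P → Action K → Config P K → Prop
  | invoke {C : Config P K} {q : P} (o : Op K) :
      C.loc q = .idle → o.Valid →
      Step C q (.invoke o) (C.goto q (.loop o))
  -- Search: `p := head; r := p.next`
  | searchBegin {C : Config P K} {q : P} {o : Op K} {r : Addr} :
      C.loc q = .loop o → C.PointsTo head r →
      Step C q .searchBegin (C.goto q (.search o head r))
  -- Search: `key > r.key`; `p := r; r := r.next`
  | searchAdvance {C : Config P K} {q : P} {o : Op K} {p r r' : Addr} {x : EKey K} :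
      C.loc q = .search o p r → C.HasKey r x → x < ekey o.key → C.PointsTo r r' →
      Step C q .searchAdvance (C.goto q (.search o r r'))
  -- Search: `key ≤ r.key`; return `⟨r, p⟩`
  | searchReturn {C : Config P K} {q : P} {o : Op K} {p r : Addr} {x : EKey K} :
      C.loc q = .search o p r → C.HasKey r x → ekey o.key ≤ x →
      Step C q .searchReturn (C.goto q (.found o p r))
  -- Get: `key = r.key`; return `r.count`
  | getPresent {C : Config P K} {q : P} {k : K} {p r : Addr} {v : ℕ} :
      C.loc q = .found (.get k) p r → C.HasKey r (ekey k) → C.HasCount r v →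
      Step C q (.ret (.num v)) (C.goto q .idle)
  -- Get: `key ≠ r.key`; return 0
  | getAbsent {C : Config P K} {q : P} {k : K} {p r : Addr} {x : EKey K} :
      C.loc q = .found (.get k) p r → C.HasKey r x → x ≠ ekey k →
      Step C q (.ret (.num 0)) (C.goto q .idle)
  -- Insert: `key = r.key`; `localr := LLX(r)`
  | insLlxR {C : Config P K} {q : P} {k : K} {c : ℕ} {p r : Addr} {lr : LlxResult} :
      C.loc q = .found (.insert k c) p r → C.HasKey r (ekey k) → C.LlxReturns r lr →
      Step C q (.llx r) (C.llx q r lr (.insR k c r lr))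
  | insRestartR {C : Config P K} {q : P} {k : K} {c : ℕ} {r : Addr} {lr : LlxResult} :
      C.loc q = .insR k c r lr → (∀ m n, lr ≠ .snap m n) →
      Step C q .restart (C.goto q (.loop (.insert k c)))
  -- Insert: `SCX(⟨r⟩, ⟨⟩, &r.count, localr.count + count)`
  | insScxR {C : Config P K} {q : P} {k : K} {c : ℕ} {r : Addr} {m : ℕ} {n : Option Addr} :
      C.loc q = .insR k c r (.snap m n) →
      Step C q .scxInvoke
        (C.invokeScx q (.insert k c) { V := [r], R := [], upd := .count r (m + c) })
  -- Insert: `key ≠ r.key`; `localp := LLX(p)`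
  | insLlxP {C : Config P K} {q : P} {k : K} {c : ℕ} {p r : Addr} {x : EKey K}
      {lp : LlxResult} :
      C.loc q = .found (.insert k c) p r → C.HasKey r x → x ≠ ekey k → C.LlxReturns p lp →
      Step C q (.llx p) (C.llx q p lp (.insP k c p r lp))
  | insRestartP {C : Config P K} {q : P} {k : K} {c : ℕ} {p r : Addr} {lp : LlxResult} :
      C.loc q = .insP k c p r lp → (∀ m, lp ≠ .snap m (some r)) →
      Step C q .restart (C.goto q (.loop (.insert k c)))
  -- Insert: `r = localp.next`; `SCX(⟨p⟩, ⟨⟩, &p.next, new Node(key, count, r))`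
  | insScxP {C : Config P K} {q : P} {k : K} {c : ℕ} {p r : Addr} {m : ℕ} {a : Addr} :
      C.loc q = .insP k c p r (.snap m (some r)) → C.heap a = none →
      Step C q .scxInvoke
        ((C.alloc a ⟨ekey k, c, some r⟩).invokeScx q (.insert k c)
          { V := [p], R := [], upd := .next p a })
  -- Delete: `localp := LLX(p)`
  | delLlxP {C : Config P K} {q : P} {k : K} {c : ℕ} {p r : Addr} {lp : LlxResult} :
      C.loc q = .found (.delete k c) p r → C.LlxReturns p lp →
      Step C q (.llx p) (C.llx q p lp (.delP k c p r lp))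
  -- Delete: `localr := LLX(r)`
  | delLlxR {C : Config P K} {q : P} {k : K} {c : ℕ} {p r : Addr} {lp lr : LlxResult} :
      C.loc q = .delP k c p r lp → C.LlxReturns r lr →
      Step C q (.llx r) (C.llx q r lr (.delPR k c p r lp lr))
  -- Delete: `localp` or `localr` is in `{Fail, Finalized}`, or `r ≠ localp.next`
  | delRestart {C : Config P K} {q : P} {k : K} {c : ℕ} {p r : Addr} {lp lr : LlxResult} :
      C.loc q = .delPR k c p r lp lr →
      ¬ ((∃ m, lp = .snap m (some r)) ∧ (∃ m n, lr = .snap m n)) →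
      Step C q .restart (C.goto q (.loop (.delete k c)))
  -- Delete: `key ≠ r.key` or `localr.count < count`; return False
  | delFalse {C : Config P K} {q : P} {k : K} {c : ℕ} {p r : Addr} {x : EKey K}
      {mp mr : ℕ} {n : Option Addr} :
      C.loc q = .delPR k c p r (.snap mp (some r)) (.snap mr n) →
      C.HasKey r x → (x ≠ ekey k ∨ mr < c) →
      Step C q (.ret (.bool false)) (C.goto q .idle)
  -- Delete: `localr.count > count`;
  -- `SCX(⟨p, r⟩, ⟨r⟩, &p.next, new Node(r.key, localr.count - count, localr.next))`
  | delScxMore {C : Config P K} {q : P} {k : K} {c : ℕ} {p r : Addr}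
      {mp mr : ℕ} {n : Option Addr} {a : Addr} :
      C.loc q = .delPR k c p r (.snap mp (some r)) (.snap mr n) →
      C.HasKey r (ekey k) → c < mr → C.heap a = none →
      Step C q .scxInvoke
        ((C.alloc a ⟨ekey k, mr - c, n⟩).invokeScx q (.delete k c)
          { V := [p, r], R := [r], upd := .next p a })
  -- Delete: `localr.count = count`; `LLX(localr.next)`
  | delLlxNext {C : Config P K} {q : P} {k : K} {c : ℕ} {p r : Addr}
      {mp mr : ℕ} {rnext : Addr} {ln : LlxResult} :
      C.loc q = .delPR k c p r (.snap mp (some r)) (.snap mr (some rnext)) →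
      C.HasKey r (ekey k) → mr = c → C.LlxReturns rnext ln →
      Step C q (.llx rnext) (C.llx q rnext ln (.delNext k c p r rnext ln))
  | delRestartNext {C : Config P K} {q : P} {k : K} {c : ℕ} {p r rnext : Addr}
      {ln : LlxResult} :
      C.loc q = .delNext k c p r rnext ln → (∀ m n, ln ≠ .snap m n) →
      Step C q .restart (C.goto q (.loop (.delete k c)))
  -- Delete: `SCX(⟨p, r, rnext⟩, ⟨r, rnext⟩, &p.next, new copy of rnext)`
  | delScxAll {C : Config P K} {q : P} {k : K} {c : ℕ} {p r rnext : Addr} {x : EKey K}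
      {m : ℕ} {n : Option Addr} {a : Addr} :
      C.loc q = .delNext k c p r rnext (.snap m n) → C.HasKey rnext x → C.heap a = none →
      Step C q .scxInvoke
        ((C.alloc a ⟨x, m, n⟩).invokeScx q (.delete k c)
          { V := [p, r, rnext], R := [r, rnext], upd := .next p a })
  -- An invoked SCX is linearized ...
  | scxLinearize {C : Config P K} {q : P} {o : Op K} {S : Scx} {link : Addr → Option ℕ} :
      C.loc q = .scx o S link → C.Unchanged S link →
      Step C q .scxLinearize (C.linearizeScx q o S)
  -- ... or it returns False without being linearized (at any time), and the loop is repeated.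
  | scxFalse {C : Config P K} {q : P} {o : Op K} {S : Scx} {link : Addr → Option ℕ} :
      C.loc q = .scx o S link →
      Step C q .scxFalse (C.goto q (.loop o))
  -- A linearized SCX returns True, and the operation returns.
  | insReturn {C : Config P K} {q : P} {k : K} {c : ℕ} :
      C.loc q = .scxDone (.insert k c) →
      Step C q (.ret .done) (C.goto q .idle)
  | delReturn {C : Config P K} {q : P} {k : K} {c : ℕ} :
      C.loc q = .scxDone (.delete k c) →
      Step C q (.ret (.bool true)) (C.goto q .idle)

/-- An execution: a sequence of configurations `conf 0, conf 1, …`, where step number `t` leads from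
`conf t` to `conf (t + 1)`. `act t = none` means that nothing happens (so finite executions are
included). -/
structure Execution (P K : Type*) [DecidableEq P] [LinearOrder K] where
  conf : ℕ → Config P K
  act : ℕ → Option (P × Action K)
  init : conf 0 = Config.initial P K
  idle : ∀ t, act t = none → conf (t + 1) = conf t
  step : ∀ t q a, act t = some (q, a) → Step (conf t) q a (conf (t + 1))

/-! ### Linearization points -/

section Linearization

variable {P K : Type*} [DecidableEq P] [LinearOrder K]

/-- Step `s` is a step `a` of process `q`, performed in the execution of the operation `o` that `q`
invoked in step `i`. -/
def Execution.StepOf (E : Execution P K) (i : ℕ) (q : P) (o : Op K) (s : ℕ) (a : Action K) :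
    Prop :=
  E.act i = some (q, .invoke o) ∧ i < s ∧ E.act s = some (q, a) ∧
    ∀ j, i < j → j ≤ s → ∀ o', E.act j ≠ some (q, .invoke o')

/-- Step `u` is the last step `a` of process `q` before step `e`. -/
def Execution.LastBefore (E : Execution P K) (q : P) (a : Action K) (u e : ℕ) : Prop :=
  u < e ∧ E.act u = some (q, a) ∧ ∀ w, u < w → w < e → E.act w ≠ some (q, a)

/-- A linearized operation: the number `inv` of its invocation step, the operation `op`, and its
linearization point `pt`, which is `2 * j` for the configuration `conf j`, and `2 * s + 1` for the
step number `s` from `conf s` to `conf (s + 1)`. -/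
structure LinOp (K : Type*) where
  inv : ℕ
  op : Op K
  pt : ℕ

/-- The linearization points. -/
inductive Execution.Linearized (E : Execution P K) : LinOp K → Prop
  /-- An Insert or Delete that performs a linearized SCX is linearized at that SCX. -/
  | effective {i : ℕ} {q : P} {o : Op K} {s : ℕ} :
      E.StepOf i q o s .scxLinearize →
      E.Linearized ⟨i, o, 2 * s + 1⟩
  /-- A Get that sees `r.key ≠ key` is linearized at the last time during its Search when `p` is in
  the data structure and `p.next` points to `r`. -/
  | getAbsent {i : ℕ} {q : P} {k : K} {p r : Addr} {x : EKey K} {v e s₀ s₁ j : ℕ} :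
      E.StepOf i q (.get k) e (.ret (.num v)) →
      (E.conf e).loc q = .found (.get k) p r →
      (E.conf e).HasKey r x → x ≠ ekey k →
      E.LastBefore q .searchBegin s₀ e → E.LastBefore q .searchReturn s₁ e →
      IsGreatest {t | s₀ ≤ t ∧ t ≤ s₁ ∧ (E.conf t).InDS p ∧ (E.conf t).PointsTo p r} j →
      E.Linearized ⟨i, .get k, 2 * j⟩
  /-- A Get that sees `r.key = key` is linearized at the last time after the start of its Search, and
  at or before its read of the value `v` from `r.count`, when `r` is in the data structure and
  `r.count = v`. -/
  | getPresent {i : ℕ} {q : P} {k : K} {p r : Addr} {v e s₀ j : ℕ} :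
      E.StepOf i q (.get k) e (.ret (.num v)) →
      (E.conf e).loc q = .found (.get k) p r →
      (E.conf e).HasKey r (ekey k) →
      E.LastBefore q .searchBegin s₀ e →
      IsGreatest {t | s₀ ≤ t ∧ t ≤ e ∧ (E.conf t).InDS r ∧ (E.conf t).HasCount r v} j →
      E.Linearized ⟨i, .get k, 2 * j⟩
  /-- A Delete that returns False after seeing `r.key ≠ key` is linearized at the last time during its
  last Search when `p` is in the data structure and `p.next` points to `r`. -/
  | deleteAbsent {i : ℕ} {q : P} {k : K} {c : ℕ} {p r : Addr} {lp lr : LlxResult} {x : EKey K}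
      {e s₀ s₁ j : ℕ} :
      E.StepOf i q (.delete k c) e (.ret (.bool false)) →
      (E.conf e).loc q = .delPR k c p r lp lr →
      (E.conf e).HasKey r x → x ≠ ekey k →
      E.LastBefore q .searchBegin s₀ e → E.LastBefore q .searchReturn s₁ e →
      IsGreatest {t | s₀ ≤ t ∧ t ≤ s₁ ∧ (E.conf t).InDS p ∧ (E.conf t).PointsTo p r} j →
      E.Linearized ⟨i, .delete k c, 2 * j⟩
  /-- A Delete that returns False after seeing `r.key = key` and `localr.count < count` is linearized
  at the last time after the start of its last Search, and at or before its `LLX(r)`, when `r` is in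
  the data structure and `r.count = localr.count`. -/
  | deletePresent {i : ℕ} {q : P} {k : K} {c : ℕ} {p r : Addr} {lp : LlxResult} {v : ℕ}
      {n : Option Addr} {e s₀ u j : ℕ} :
      E.StepOf i q (.delete k c) e (.ret (.bool false)) →
      (E.conf e).loc q = .delPR k c p r lp (.snap v n) →
      (E.conf e).HasKey r (ekey k) → v < c →
      E.LastBefore q .searchBegin s₀ e → E.LastBefore q (.llx r) u e →
      IsGreatest {t | s₀ ≤ t ∧ t ≤ u ∧ (E.conf t).InDS r ∧ (E.conf t).HasCount r v} j →
      E.Linearized ⟨i, .delete k c, 2 * j⟩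

/-- `l` is the sequence of the operations linearized up to time `t` (up to `conf t`), in the order of
their linearization points; operations with the same linearization point are in any order. -/
def Execution.IsLinSeq (E : Execution P K) (t : ℕ) (l : List (LinOp K)) : Prop :=
  l.Nodup ∧ (∀ x, x ∈ l ↔ E.Linearized x ∧ x.pt ≤ 2 * t) ∧ l.Pairwise (fun x y => x.pt ≤ y.pt)

/-- No operation has two linearization points, and every operation that returns has one, between its
invocation and its response. -/
def Execution.LinWellDefined (E : Execution P K) : Prop :=
  (∀ x y, E.Linearized x → E.Linearized y → x.inv = y.inv → x = y) ∧
    ∀ i q o e v, E.StepOf i q o e (.ret v) →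
      ∃ pt, E.Linearized ⟨i, o, pt⟩ ∧ 2 * i < pt ∧ pt ≤ 2 * e

end Linearization

end LLXMultiset

set_option linter.unusedSectionVars false

namespace LLXMultiset

/-! ### Linked lists in the heap -/

/-- Following the `next` pointers from `x` leads through the nodes of the list to `y`. -/
def Seg {K : Type*} (h : Addr → Option (Node K)) : Option Addr → List Addr → Option Addr → Prop
  | x, [], y => x = y
  | x, a :: l, y => x = some a ∧ ∃ nd, h a = some nd ∧ Seg h nd.next l y

/-- Both addresses hold nodes, and the key of the first is smaller. -/
def KeyLt {K : Type*} [LinearOrder K] (h : Addr → Option (Node K)) (a b : Addr) : Prop :=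
  ∃ nd nd', h a = some nd ∧ h b = some nd' ∧ nd.key < nd'.key

/-- Every `next` pointer leads to a node with a larger key. -/
def Increasing {K : Type*} [LinearOrder K] (h : Addr → Option (Node K)) : Prop :=
  ∀ a nd b, h a = some nd → nd.next = some b → ∃ nd', h b = some nd' ∧ nd.key < nd'.key

/-- The number of occurrences of `k` in the node at address `a`. -/
def occ {K : Type*} [LinearOrder K] (h : Addr → Option (Node K)) (k : K) (a : Addr) : ℕ :=
  (h a).elim 0 fun nd => if nd.key = ekey k then nd.count else 0

/-- The number of occurrences of `k` in the nodes of a list. -/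
def total {K : Type*} [LinearOrder K] (h : Addr → Option (Node K)) (k : K) (l : List Addr) : ℕ :=
  (l.map (occ h k)).sum

/-- The effect of a successful operation on the number of occurrences of `x`. -/
def Op.Effect {K : Type*} [LinearOrder K] (x : K) (old new : ℕ) : Op K → Prop
  | .get _ => False
  | .insert k c => new = old + (Multiset.replicate c k).count x
  | .delete k c => new + (Multiset.replicate c k).count x = old

/-- The new node of an update. -/
def Update.newNode : Update → Option Addr
  | .count _ _ => none
  | .next _ a => some a

/-- The address whose field is updated. -/
def Update.target : Update → Addr
  | .count r _ => r
  | .next r _ => r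

/-- The SCX `S` performs the operation `o` if it is linearized with heap `h`: it increases a count,
or replaces a segment of the list by a new node. -/
inductive Ready {K : Type*} [LinearOrder K] (h : Addr → Option (Node K)) : Op K → Scx → Prop
  | count {k : K} {c : ℕ} {r : Addr} {nd : Node K} :
      h r = some nd → nd.key = ekey k →
      Ready h (.insert k c) ⟨[r], [], .count r (nd.count + c)⟩
  | splice {o : Op K} {p a : Addr} {mid : List Addr} {nd na : Node K} :
      h p = some nd → h a = some na → nd.key < na.key → Seg h nd.next mid na.next →
      (∀ k, o.Effect k (total h k mid) (occ h k a)) →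
      Ready h o ⟨p :: mid, mid, .next p a⟩

section Heap

variable {K : Type*}

theorem Seg.append {h : Addr → Option (Node K)} {l₁ l₂ : List Addr} {x y : Option Addr} :
    Seg h x (l₁ ++ l₂) y ↔ ∃ z, Seg h x l₁ z ∧ Seg h z l₂ y := by
  induction l₁ generalizing x with
  | nil => simp [Seg]
  | cons a l ih =>
    simp only [List.cons_append, Seg, ih]
    constructor
    · rintro ⟨rfl, nd, ha, z, hz, hy⟩
      exact ⟨z, ⟨rfl, nd, ha, hz⟩, hy⟩
    · rintro ⟨z, ⟨rfl, nd, ha, hz⟩, hy⟩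
      exact ⟨rfl, nd, ha, z, hz, hy⟩

theorem Seg.congr {h h' : Addr → Option (Node K)} {l : List Addr} {x y : Option Addr}
    (hs : Seg h x l y) (hh : ∀ a ∈ l, h' a = h a) : Seg h' x l y := by
  induction l generalizing x with
  | nil => exact hs
  | cons a l ih =>
    obtain ⟨rfl, nd, ha, hl⟩ := hs
    exact ⟨rfl, nd, by rw [hh a (by simp), ha], ih hl fun b hb => hh b (by simp [hb])⟩

theorem Seg.congr_next {h h' : Addr → Option (Node K)} {l : List Addr} {x y : Option Addr}
    (hs : Seg h x l y)
    (hh : ∀ a nd, h a = some nd → ∃ nd', h' a = some nd' ∧ nd'.next = nd.next) :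
    Seg h' x l y := by
  induction l generalizing x with
  | nil => exact hs
  | cons a l ih =>
    obtain ⟨rfl, nd, ha, hl⟩ := hs
    obtain ⟨nd', ha', hn⟩ := hh a nd ha
    exact ⟨rfl, nd', ha', by rw [hn]; exact ih hl⟩

/-- A segment is a prefix of every Nil-terminated list with the same start. -/
theorem Seg.exists_append {h : Addr → Option (Node K)} {l l' : List Addr} {x y : Option Addr}
    (hs : Seg h x l y) (hs' : Seg h x l' none) : ∃ r, l' = l ++ r ∧ Seg h y r none := by
  induction l generalizing x l' with
  | nil =>
    obtain rfl : x = y := hs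
    exact ⟨l', rfl, hs'⟩
  | cons a l ih =>
    obtain ⟨rfl, nd, ha, hl⟩ := hs
    cases l' with
    | nil => simp [Seg] at hs'
    | cons b l' =>
      obtain ⟨hb, nd', ha', hl'⟩ := hs'
      cases hb
      rw [ha] at ha'
      cases ha'
      obtain ⟨r, rfl, hr⟩ := ih hl hl'
      exact ⟨r, rfl, hr⟩

theorem Seg.exists_node {h : Addr → Option (Node K)} {l : List Addr} {x y : Option Addr}
    (hs : Seg h x l y) {a : Addr} (ha : a ∈ l) : ∃ nd, h a = some nd := by
  induction l generalizing x with
  | nil => simp at ha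
  | cons b l ih =>
    obtain ⟨rfl, nd, hb, hl⟩ := hs
    rcases List.mem_cons.1 ha with rfl | ha
    · exact ⟨nd, hb⟩
    · exact ih hl ha

theorem Seg.mem_of_next {h : Addr → Option (Node K)} {l : List Addr} {x : Option Addr}
    (hs : Seg h x l none) {a b : Addr} {nd : Node K} (ha : a ∈ l) (hnd : h a = some nd)
    (hb : nd.next = some b) : b ∈ l := by
  obtain ⟨l₁, l₂, rfl⟩ := List.append_of_mem ha
  obtain ⟨z, -, -, nd', ha', hl⟩ := Seg.append.1 hs
  rw [hnd] at ha'
  cases ha'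
  rw [hb] at hl
  cases l₂ with
  | nil => simp [Seg] at hl
  | cons c l₂ =>
    obtain ⟨hc, -⟩ := hl
    cases hc
    simp

theorem Seg.inDS_iff {P : Type*} {C : Config P K} {l : List Addr}
    (hs : Seg C.heap (some head) l none) (r : Addr) : C.InDS r ↔ r ∈ l := by
  constructor
  · intro hr
    induction hr with
    | refl =>
      cases l with
      | nil => simp [Seg] at hs
      | cons a l =>
        obtain ⟨ha, -⟩ := hs
        cases ha
        simp
    | tail _ hbc ih =>
      obtain ⟨nd, h1, h2⟩ := hbc
      exact hs.mem_of_next ih h1 h2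
  · have key : ∀ (l : List Addr) (a : Addr) (y : Option Addr), Seg C.heap (some a) l y →
        ∀ r ∈ l, Relation.ReflTransGen C.PointsTo a r := by
      intro l
      induction l with
      | nil => simp
      | cons b l ih =>
        rintro a y ⟨hab, nd, hb, hl⟩ r hr
        cases hab
        rcases List.mem_cons.1 hr with rfl | hr
        · exact .refl
        · cases l with
          | nil => simp at hr
          | cons c l =>
            obtain ⟨hn, h2⟩ := hl
            exact .head ⟨nd, hb, hn⟩ (ih c y ⟨rfl, h2⟩ r hr)
    exact key l head none hs r

theorem Update.apply_of_ne {h : Addr → Option (Node K)} {u : Update} {a : Addr}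
    (ha : a ≠ u.target) : u.apply h a = h a := by
  cases u <;> exact Function.update_of_ne ha _ _

theorem Update.apply_key {h : Addr → Option (Node K)} {u : Update} {a : Addr} {nd : Node K}
    (ha : h a = some nd) : ∃ nd', u.apply h a = some nd' ∧ nd'.key = nd.key := by
  by_cases hat : a = u.target
  · cases u <;> simp only [Update.target] at hat <;> subst hat <;> simp [Update.apply, ha]
  · exact ⟨nd, by rw [apply_of_ne hat, ha], rfl⟩

variable [LinearOrder K]

theorem KeyLt.trans {h : Addr → Option (Node K)} {a b c : Addr} (h₁ : KeyLt h a b)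
    (h₂ : KeyLt h b c) : KeyLt h a c := by
  obtain ⟨na, nb, ha, hb, hab⟩ := h₁
  obtain ⟨nb', nc, hb', hc, hbc⟩ := h₂
  rw [hb] at hb'
  cases hb'
  exact ⟨na, nc, ha, hc, hab.trans hbc⟩

theorem KeyLt.ne {h : Addr → Option (Node K)} {a b : Addr} (hab : KeyLt h a b) : a ≠ b := by
  rintro rfl
  obtain ⟨na, nb, ha, hb, hlt⟩ := hab
  rw [ha] at hb
  cases hb
  exact lt_irrefl _ hlt

theorem Seg.pairwise {h : Addr → Option (Node K)} (hi : Increasing h) {l : List Addr}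
    {x y : Option Addr} (hs : Seg h x l y) : l.Pairwise (KeyLt h) := by
  induction l generalizing x with
  | nil => exact .nil
  | cons a l ih =>
    obtain ⟨rfl, nd, ha, hl⟩ := hs
    have hp := ih hl
    refine .cons ?_ hp
    cases l with
    | nil => simp
    | cons b l =>
      obtain ⟨hb, -⟩ := hl
      obtain ⟨nd', hb', hlt⟩ := hi a nd b ha hb
      have hab : KeyLt h a b := ⟨nd, nd', ha, hb', hlt⟩
      intro c hc
      rcases List.mem_cons.1 hc with rfl | hc
      · exact hab
      · exact hab.trans ((List.pairwise_cons.1 hp).1 c hc)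

theorem Seg.nodup {h : Addr → Option (Node K)} (hi : Increasing h) {l : List Addr}
    {x y : Option Addr} (hs : Seg h x l y) : l.Nodup :=
  (hs.pairwise hi).imp KeyLt.ne

theorem occ_congr {h h' : Addr → Option (Node K)} {a : Addr} (hh : h' a = h a) (k : K) :
    occ h' k a = occ h k a := by
  simp [occ, hh]

theorem total_congr {h h' : Addr → Option (Node K)} {l : List Addr}
    (hh : ∀ a ∈ l, h' a = h a) (k : K) : total h' k l = total h k l := by
  unfold total
  congr 1
  exact List.map_congr_left fun a ha => occ_congr (hh a ha) k

theorem total_append (h : Addr → Option (Node K)) (k : K) (l₁ l₂ : List Addr) :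
    total h k (l₁ ++ l₂) = total h k l₁ + total h k l₂ := by
  simp [total]

theorem total_cons (h : Addr → Option (Node K)) (k : K) (a : Addr) (l : List Addr) :
    total h k (a :: l) = occ h k a + total h k l := by
  simp [total]

theorem total_nil (h : Addr → Option (Node K)) (k : K) : total h k [] = 0 := rfl

theorem total_eq_zero {h : Addr → Option (Node K)} {k : K} {l : List Addr}
    (hl : ∀ a ∈ l, ∀ nd, h a = some nd → nd.key ≠ ekey k) : total h k l = 0 := by
  refine List.sum_eq_zero fun n hn => ?_
  obtain ⟨a, ha, rfl⟩ := List.mem_map.1 hn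
  cases hd : h a with
  | none => simp [occ, hd]
  | some nd => simp [occ, hd, hl a ha nd hd]

/-- In a list with increasing keys, only one node contributes occurrences of a key. -/
theorem Seg.total_eq {h : Addr → Option (Node K)} (hi : Increasing h) {l : List Addr}
    {x y : Option Addr} (hs : Seg h x l y) {a : Addr} (ha : a ∈ l) {nd : Node K}
    (hnd : h a = some nd) {k : K} (hk : nd.key = ekey k) : total h k l = nd.count := by
  have hp := hs.pairwise hi
  obtain ⟨l₁, l₂, rfl⟩ := List.append_of_mem ha
  rw [List.pairwise_append, List.pairwise_cons] at hp
  obtain ⟨-, ⟨h2, -⟩, h1⟩ := hp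
  rw [total_append, total_cons, total_eq_zero (l := l₁), total_eq_zero (l := l₂)]
  · simp [occ, hnd, hk]
  · intro b hb nd' hb' he
    obtain ⟨n1, n2, e1, e2, hlt⟩ := h2 b hb
    rw [hnd] at e1
    rw [hb'] at e2
    cases e1
    cases e2
    rw [hk, he] at hlt
    exact lt_irrefl _ hlt
  · intro b hb nd' hb' he
    obtain ⟨n1, n2, e1, e2, hlt⟩ := h1 b hb a (by simp)
    rw [hnd] at e2
    rw [hb'] at e1
    cases e1
    cases e2
    rw [hk, he] at hlt
    exact lt_irrefl _ hlt

theorem occurs_iff {P : Type*} {C : Config P K} (hi : Increasing C.heap) {l : List Addr}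
    (hs : Seg C.heap (some head) l none) (k : K) (n : ℕ) :
    C.Occurs k n ↔ n = total C.heap k l := by
  unfold Config.Occurs
  constructor
  · rintro (⟨r, hr, ⟨nd, h1, h2⟩, nd', h3, rfl⟩ | ⟨hno, rfl⟩)
    · rw [h1] at h3
      cases h3
      exact (hs.total_eq hi ((hs.inDS_iff r).1 hr) h1 h2).symm
    · exact (total_eq_zero fun a ha nd hnd hk =>
        hno ⟨a, (hs.inDS_iff a).2 ha, nd, hnd, hk⟩).symm
  · rintro rfl
    by_cases hex : ∃ r, C.InDS r ∧ C.HasKey r (ekey k)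
    · obtain ⟨r, hr, nd, h1, h2⟩ := hex
      exact .inl ⟨r, hr, ⟨nd, h1, h2⟩, nd, h1,
        (hs.total_eq hi ((hs.inDS_iff r).1 hr) h1 h2).symm⟩
    · exact .inr ⟨hex, total_eq_zero fun a ha nd hnd hk =>
        hex ⟨a, (hs.inDS_iff a).2 ha, nd, hnd, hk⟩⟩

theorem isKeyMultiset_iff {P : Type*} {C : Config P K} (hi : Increasing C.heap)
    {l : List Addr} (hs : Seg C.heap (some head) l none) (σ : Multiset K) :
    C.IsKeyMultiset σ ↔ ∀ k, total C.heap k l = σ.count k := by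
  simp only [Config.IsKeyMultiset, occurs_iff hi hs]
  exact ⟨fun h k => (h k _).1 rfl, fun h k n => by rw [h k]⟩

theorem Op.Effect.add {o : Op K} {k : K} {m n : ℕ} (h : o.Effect k m n) (x : ℕ) :
    o.Effect k (m + x) (n + x) := by
  cases o <;> simp only [Op.Effect] at * <;> omega

theorem Op.Effect.count_exec {o : Op K} {σ : Multiset K} {f : K → ℕ}
    (h : ∀ k, o.Effect k (σ.count k) (f k)) (k : K) : f k = (o.exec σ).count k := by
  have hk := h k
  cases o with
  | get _ => exact hk.elim
  | insert k' c => simpa [Op.exec, Op.Effect] using hk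
  | delete k' c =>
    have hk' := h k'
    simp only [Op.Effect, Multiset.count_replicate_self] at hk hk'
    rw [Op.exec, if_pos (by omega), Multiset.count_sub]
    omega

theorem Ready.congr {h h' : Addr → Option (Node K)} {o : Op K} {S : Scx} (hr : Ready h o S)
    (hV : ∀ a ∈ S.V, h' a = h a) (hnew : ∀ a, S.upd.newNode = some a → h' a = h a) :
    Ready h' o S := by
  cases hr with
  | count h1 h2 => exact .count (by rw [hV _ (by simp), h1]) h2
  | splice h1 h2 h3 h4 h5 =>
    have hm := fun b hb => hV b (List.mem_cons_of_mem _ hb)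
    refine .splice (by rw [hV _ (by simp), h1]) (by rw [hnew _ rfl, h2]) h3 (h4.congr hm) ?_
    intro k
    rw [total_congr hm, occ_congr (hnew _ rfl)]
    exact h5 k

theorem Ready.subset {h : Addr → Option (Node K)} {o : Op K} {S : Scx} (hr : Ready h o S) :
    S.R ⊆ S.V := by
  cases hr <;> simp

theorem Ready.target_mem {h : Addr → Option (Node K)} {o : Op K} {S : Scx} (hr : Ready h o S) :
    S.upd.target ∈ S.V := by
  cases hr <;> simp [Update.target]

theorem Ready.target_notMem {h : Addr → Option (Node K)} {o : Op K} {S : Scx} (hr : Ready h o S)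
    (hi : Increasing h) : S.upd.target ∉ S.R := by
  cases hr with
  | count h1 h2 => simp
  | @splice _ p a mid nd na h1 h2 h3 h4 h5 =>
    have hpm : Seg h (some p) (p :: mid) na.next := ⟨rfl, nd, h1, h4⟩
    exact (List.nodup_cons.1 (hpm.nodup hi)).1

/-- The `next` pointer of a node after an update is the old one or points to the new node. -/
theorem Ready.next_apply {h : Addr → Option (Node K)} {o : Op K} {S : Scx} (hr : Ready h o S)
    {a b : Addr} {nd' : Node K} (ha : S.upd.apply h a = some nd') (hb : nd'.next = some b) :
    ∃ nd, h a = some nd ∧ nd.key = nd'.key ∧ (nd.next = some b ∨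
      S.upd.newNode = some b ∧ a = S.upd.target ∧ ∃ nb, h b = some nb ∧ nd.key < nb.key) := by
  by_cases hat : a = S.upd.target
  · cases hr with
    | count h1 h2 =>
      cases hat
      simp only [Update.apply, Update.target, Function.update_self, h1, Option.map_some,
        Option.some.injEq] at ha
      subst ha
      exact ⟨_, h1, rfl, .inl hb⟩
    | splice h1 h2 h3 h4 h5 =>
      cases hat
      simp only [Update.apply, Update.target, Function.update_self, h1, Option.map_some,
        Option.some.injEq] at ha
      subst ha
      cases hb
      exact ⟨_, h1, rfl, .inr ⟨rfl, rfl, _, h2, h3⟩⟩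
  · rw [Update.apply_of_ne hat] at ha
    exact ⟨nd', ha, rfl, .inl hb⟩

theorem Ready.increasing_apply {h : Addr → Option (Node K)} {o : Op K} {S : Scx}
    (hr : Ready h o S) (hi : Increasing h) : Increasing (S.upd.apply h) := by
  intro a nd b ha hb
  obtain ⟨n0, h0, hk, hn | ⟨-, -, nb, h1, h2⟩⟩ := hr.next_apply ha hb
  · obtain ⟨nb, h1, h2⟩ := hi a n0 b h0 hn
    obtain ⟨nb', h3, h4⟩ := Update.apply_key (u := S.upd) h1
    exact ⟨nb', h3, by rw [h4, ← hk]; exact h2⟩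
  · obtain ⟨nb', h3, h4⟩ := Update.apply_key (u := S.upd) h1
    exact ⟨nb', h3, by rw [h4, ← hk]; exact h2⟩

/-- A linearized SCX replaces the list of the data structure by another one. -/
theorem Ready.exists_seg {h : Addr → Option (Node K)} {o : Op K} {S : Scx} (hr : Ready h o S)
    {l : List Addr} (hi : Increasing h) (hs : Seg h (some head) l none) (hV : S.V ⊆ l)
    (hnew : ∀ a, S.upd.newNode = some a → a ∉ l) :
    ∃ l', Seg (S.upd.apply h) (some head) l' none ∧
      (∀ x, x ∈ l' ↔ (x ∈ l ∧ x ∉ S.R) ∨ S.upd.newNode = some x) ∧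
      ∀ k, o.Effect k (total h k l) (total (S.upd.apply h) k l') := by
  have hnd := hs.nodup hi
  cases hr with
  | @count k c r nd h1 h2 =>
    refine ⟨l, hs.congr_next fun a n ha => ?_, by simp [Update.newNode], fun k' => ?_⟩
    · by_cases har : a = r
      · subst har
        simp [Update.apply, ha]
      · exact ⟨n, by simp [Update.apply, har, ha], rfl⟩
    · have hrl : r ∈ l := hV (by simp)
      obtain ⟨l₁, l₂, rfl⟩ := List.append_of_mem hrl
      rw [List.nodup_append, List.nodup_cons] at hnd
      obtain ⟨-, ⟨hn2, -⟩, hn1⟩ := hnd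
      rw [total_append, total_append, total_cons, total_cons]
      rw [total_congr (h := h) (h' := (Update.count r (nd.count + c)).apply h) (l := l₁),
        total_congr (h := h) (h' := (Update.count r (nd.count + c)).apply h) (l := l₂)]
      · simp only [Op.Effect, occ, Update.apply, Function.update_self, h1, Option.map_some,
          Option.elim_some, h2, Multiset.count_replicate]
        have : ekey k = ekey k' ↔ k = k' := by simp [ekey]
        simp only [this]
        split_ifs <;> omega
      · exact fun a ha => Update.apply_of_ne fun hat => hn2 (by cases hat; exact ha)
      · exact fun a ha => Update.apply_of_ne fun hat => hn1 a ha r (by simp) hat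
  | @splice _ p a mid nd na h1 h2 h3 h4 h5 =>
    have hpl : p ∈ l := hV (by simp)
    have hal : a ∉ l := hnew a rfl
    obtain ⟨l₁, l₂, rfl⟩ := List.append_of_mem hpl
    obtain ⟨z, hs1, rfl, nd', hp', hs2⟩ := Seg.append.1 hs
    rw [h1] at hp'
    cases hp'
    obtain ⟨l₃, rfl, hs3⟩ := h4.exists_append hs2
    have hap : a ≠ p := fun e => hal (by simp [e])
    simp only [List.nodup_append, List.nodup_cons, List.mem_append, List.mem_cons, not_or] at hnd
    obtain ⟨-, ⟨⟨hpm, hp3⟩, hm, -, hm3⟩, hd1⟩ := hnd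
    simp only [List.mem_append, List.mem_cons, not_or] at hal
    have hne : ∀ b, b ≠ p → (Update.next p a).apply h b = h b :=
      fun b hb => Update.apply_of_ne hb
    have c1 : ∀ b ∈ l₁, (Update.next p a).apply h b = h b :=
      fun b hb => hne b (hd1 b hb p (.inl rfl))
    have c3 : ∀ b ∈ l₃, (Update.next p a).apply h b = h b :=
      fun b hb => hne b fun e => hp3 (by cases e; exact hb)
    refine ⟨l₁ ++ p :: a :: l₃, ?_, ?_, ?_⟩
    · refine Seg.append.2 ⟨some p, hs1.congr c1, rfl, { nd with next := some a },
        by simp [Update.apply, h1], rfl, na, by simp [Update.apply, hap, h2], hs3.congr c3⟩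
    · intro x
      simp only [List.mem_append, List.mem_cons, Update.newNode, Option.some.injEq]
      constructor
      · rintro (hx | rfl | rfl | hx)
        · exact .inl ⟨.inl hx, fun hxm => hd1 x hx x (.inr (.inl hxm)) rfl⟩
        · exact .inl ⟨.inr (.inl rfl), hpm⟩
        · exact .inr rfl
        · exact .inl ⟨.inr (.inr (.inr hx)), fun hxm => hm3 x hxm x hx rfl⟩
      · rintro (⟨hx | hx | hx | hx, hxm⟩ | rfl)
        · exact .inl hx
        · exact .inr (.inl hx)
        · exact (hxm hx).elim
        · exact .inr (.inr (.inr hx))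
        · exact .inr (.inr (.inl rfl))
    · intro k
      have e := (h5 k).add (total h k l₁ + occ h k p + total h k l₃)
      simp only [total_append, total_cons]
      rw [total_congr c1, total_congr c3, occ_congr (hne a hap)]
      have hop : occ ((Update.next p a).apply h) k p = occ h k p := by
        simp [occ, Update.apply, h1]
      rw [hop]
      convert e using 1 <;> omega

end Heap

/-! ### The invariant -/

/-- The node to be inserted by the pending SCX of a process. -/
def Local.newNode {K : Type*} : Local K → Option Addr
  | .scx _ S _ => S.upd.newNode
  | _ => none

section Predicates

variable {P K : Type*}

/-- `r` is in the data structure, or it has been removed from it. -/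
def Config.Seen (C : Config P K) (r : Addr) : Prop :=
  C.InDS r ∨ C.Finalized r

/-- `a` has not been inserted into the data structure. -/
def Config.Private (C : Config P K) (a : Addr) : Prop :=
  a ≠ head ∧ ¬ C.Finalized a ∧ ∀ b, ¬ C.PointsTo b a

variable [LinearOrder K]

/-- According to the links `lk`, an `LLX(r)` with snapshot `m`, `nx` is linked, and the snapshot is
still valid unless `r` has been in the first argument of a linearized SCX since. -/
def Config.LinkSnap (C : Config P K) (lk : Addr → Option ℕ) (r : Addr) (m : ℕ)
    (nx : Option Addr) : Prop :=
  ∃ n, lk r = some n ∧ n ≤ C.hist.length ∧ C.heap r ≠ none ∧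
    ((∀ S ∈ C.hist.drop n, r ∉ S.V) →
      ¬ C.Finalized r ∧ ∃ nd, C.heap r = some nd ∧ nd.count = m ∧ nd.next = nx) ∧
    ∀ b, nx = some b → C.Seen b ∧ KeyLt C.heap r b

/-- `res` is not a snapshot, or a snapshot that is linked to the next SCX. -/
def Config.Linked (C : Config P K) (lk : Addr → Option ℕ) (r : Addr) (res : LlxResult) : Prop :=
  ∀ m nx, res = .snap m nx → C.LinkSnap lk r m nx

/-- What is known about a pending SCX. -/
structure Config.Pending (C : Config P K) (o : Op K) (S : Scx) (lk : Addr → Option ℕ) :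
    Prop where
  seen : ∀ r ∈ S.V, C.Seen r
  alloc : ∀ r ∈ S.V, C.heap r ≠ none
  linked : ∀ r ∈ S.V, ∃ n, lk r = some n ∧ n ≤ C.hist.length
  newNode : ∀ a, S.upd.newNode = some a → C.Private a ∧ C.heap a ≠ none
  ready : C.Unchanged S lk → (∀ r ∈ S.V, ¬ C.Finalized r) ∧ Ready C.heap o S

/-- `Search(key)` is at the nodes `p` and `r`. -/
structure Config.SearchAt (C : Config P K) (k : K) (p r : Addr) : Prop where
  seen_left : C.Seen p
  seen_right : C.Seen r
  keyLt : KeyLt C.heap p r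
  left_lt : ∃ nd, C.heap p = some nd ∧ nd.key < ekey k

/-- `Search(key)` returned `⟨r, p⟩`. -/
structure Config.FoundAt (C : Config P K) (k : K) (p r : Addr) : Prop extends
    C.SearchAt k p r where
  le_right : ∃ nd, C.heap r = some nd ∧ ekey k ≤ nd.key

/-- What is known about the local state of a process with links `lk`. -/
def Config.LocalInv (C : Config P K) (lk : Addr → Option ℕ) : Local K → Prop
  | .idle => True
  | .loop _ => True
  | .search o p r => C.SearchAt o.key p r
  | .found o p r => C.FoundAt o.key p r
  | .insR k _ r lr => C.Seen r ∧ C.HasKey r (ekey k) ∧ C.Linked lk r lr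
  | .insP k _ p r lp => C.FoundAt k p r ∧ (∃ nd, C.heap r = some nd ∧ ekey k < nd.key) ∧
      C.Linked lk p lp
  | .delP k _ p r lp => C.FoundAt k p r ∧ C.Linked lk p lp
  | .delPR k _ p r lp lr => C.FoundAt k p r ∧ C.Linked lk p lp ∧ C.Linked lk r lr
  | .delNext k c p r rnext ln => C.FoundAt k p r ∧ C.HasKey r (ekey k) ∧
      (∃ m, C.LinkSnap lk p m (some r)) ∧ C.LinkSnap lk r c (some rnext) ∧ C.Linked lk rnext ln
  | .scx o S link => C.Pending o S link
  | .scxDone _ => True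

/-- The invariant of the algorithm. -/
structure Config.Inv (C : Config P K) : Prop where
  head_key : C.HasKey head ⊥
  increasing : Increasing C.heap
  exists_seg : ∃ l, Seg C.heap (some head) l none
  not_inDS : ∀ r, C.Finalized r → ¬ C.InDS r
  alloc : ∀ r, C.Finalized r → C.heap r ≠ none
  seen_next : ∀ r b, C.Finalized r → C.PointsTo r b → C.Seen b
  loc : ∀ q, C.LocalInv (C.link q) (C.loc q)
  newNode_inj : ∀ q₁ q₂ a, (C.loc q₁).newNode = some a → (C.loc q₂).newNode = some a → q₁ = q₂

/-- The ways in which the shared memory can change. -/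
structure Config.Evolve (C C' : Config P K) : Prop where
  key : ∀ a nd, C.heap a = some nd → ∃ nd', C'.heap a = some nd' ∧ nd'.key = nd.key
  seen : ∀ r, C.Seen r → C'.Seen r
  hist : ∃ ext, C'.hist = C.hist ++ ext ∧ ∀ a, C.heap a ≠ none → (∀ S ∈ ext, a ∉ S.V) →
    C'.heap a = C.heap a ∧ (C'.Finalized a → C.Finalized a)

end Predicates

section Invariance

variable {P K : Type*}

theorem Config.Private.not_seen {C : Config P K} {a : Addr} (ha : C.Private a) :
    ¬ C.Seen a := by
  rintro (h | h)
  · rcases Relation.ReflTransGen.cases_tail h with h | ⟨b, -, hb⟩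
    · exact ha.1 h
    · exact ha.2.2 b hb
  · exact ha.2.1 h

theorem Config.finalized_congr {C C' : Config P K} (h : C'.hist = C.hist) (r : Addr) :
    C'.Finalized r ↔ C.Finalized r := by
  simp [Config.Finalized, h]

theorem Config.HasKey.unique {C : Config P K} {r : Addr} {x y : EKey K} (hx : C.HasKey r x)
    (hy : C.HasKey r y) : x = y := by
  obtain ⟨n, h, rfl⟩ := hx
  obtain ⟨n', h', rfl⟩ := hy
  rw [h] at h'
  cases h'
  rfl

variable [LinearOrder K]

namespace Config.Evolve

variable {C C' : Config P K}

theorem of_eq (h₁ : C'.heap = C.heap) (h₂ : C'.hist = C.hist) : C.Evolve C' := by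
  refine ⟨fun a nd h => ⟨nd, by rw [h₁, h], rfl⟩, fun r hr => ?_, [], by simp [h₂], ?_⟩
  · have e : C'.PointsTo = C.PointsTo := by
      funext a b
      simp [Config.PointsTo, h₁]
    simpa only [Config.Seen, Config.InDS, e, finalized_congr h₂] using hr
  · exact fun a _ _ => ⟨by rw [h₁], (finalized_congr h₂ a).1⟩

theorem alloc_ne (e : C.Evolve C') {a : Addr} (h : C.heap a ≠ none) : C'.heap a ≠ none := by
  obtain ⟨nd, hnd⟩ := Option.ne_none_iff_exists'.1 h
  obtain ⟨nd', h', -⟩ := e.key a nd hnd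
  simp [h']

theorem keyLt (e : C.Evolve C') {a b : Addr} (h : KeyLt C.heap a b) : KeyLt C'.heap a b := by
  obtain ⟨na, nb, ha, hb, hlt⟩ := h
  obtain ⟨na', ha', ea⟩ := e.key a na ha
  obtain ⟨nb', hb', eb⟩ := e.key b nb hb
  exact ⟨na', nb', ha', hb', by rwa [ea, eb]⟩

theorem hasKey (e : C.Evolve C') {a : Addr} {x : EKey K} (h : C.HasKey a x) :
    C'.HasKey a x := by
  obtain ⟨na, ha, rfl⟩ := h
  exact e.key a na ha

theorem exists_key (e : C.Evolve C') {a : Addr} {p : EKey K → Prop}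
    (h : ∃ nd, C.heap a = some nd ∧ p nd.key) : ∃ nd, C'.heap a = some nd ∧ p nd.key := by
  obtain ⟨na, ha, hp⟩ := h
  obtain ⟨na', ha', ea⟩ := e.key a na ha
  exact ⟨na', ha', by rwa [ea]⟩

theorem linkSnap (e : C.Evolve C') {lk : Addr → Option ℕ} {r : Addr} {m : ℕ}
    {nx : Option Addr} (h : C.LinkSnap lk r m nx) : C'.LinkSnap lk r m nx := by
  obtain ⟨n, h1, h2, h3, h4, h5⟩ := h
  obtain ⟨ext, h6, h7⟩ := e.hist
  refine ⟨n, h1, by rw [h6, List.length_append]; omega, e.alloc_ne h3, fun hS => ?_,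
    fun b hb => ⟨e.seen b (h5 b hb).1, e.keyLt (h5 b hb).2⟩⟩
  rw [h6, List.drop_append_of_le_length h2] at hS
  obtain ⟨h8, h9⟩ := h7 r h3 fun S hS' => hS S (by simp [hS'])
  obtain ⟨h10, h11⟩ := h4 fun S hS' => hS S (by simp [hS'])
  exact ⟨fun hf => h10 (h9 hf), by rw [h8]; exact h11⟩

theorem linked (e : C.Evolve C') {lk : Addr → Option ℕ} {r : Addr} {res : LlxResult}
    (h : C.Linked lk r res) : C'.Linked lk r res :=
  fun m nx hr => e.linkSnap (h m nx hr)

theorem searchAt (e : C.Evolve C') {k : K} {p r : Addr} (h : C.SearchAt k p r) :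
    C'.SearchAt k p r :=
  ⟨e.seen p h.seen_left, e.seen r h.seen_right, e.keyLt h.keyLt,
    e.exists_key (p := fun x => x < ekey k) h.left_lt⟩

theorem foundAt (e : C.Evolve C') {k : K} {p r : Addr} (h : C.FoundAt k p r) :
    C'.FoundAt k p r :=
  ⟨e.searchAt h.toSearchAt, e.exists_key (p := fun x => ekey k ≤ x) h.le_right⟩

theorem pending (e : C.Evolve C') {o : Op K} {S : Scx} {lk : Addr → Option ℕ}
    (h : C.Pending o S lk)
    (hn : ∀ a, S.upd.newNode = some a → C'.Private a ∧ C'.heap a = C.heap a) :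
    C'.Pending o S lk := by
  obtain ⟨ext, h6, h7⟩ := e.hist
  refine ⟨fun r hr => e.seen r (h.seen r hr), fun r hr => e.alloc_ne (h.alloc r hr),
    fun r hr => ?_, fun a ha => ⟨(hn a ha).1, by rw [(hn a ha).2]; exact (h.newNode a ha).2⟩,
    fun hU => ?_⟩
  · obtain ⟨n, h1, h2⟩ := h.linked r hr
    exact ⟨n, h1, by rw [h6, List.length_append]; omega⟩
  · have hU' : C.Unchanged S lk := by
      intro r hr n hn S' hS'
      refine hU r hr n hn S' ?_
      rw [h6, List.drop_append]
      simp [hS']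
    have hext : ∀ r ∈ S.V, ∀ S' ∈ ext, r ∉ S'.V := by
      intro r hr S' hS'
      obtain ⟨n, h1, h2⟩ := h.linked r hr
      refine hU r hr n h1 S' ?_
      rw [h6, List.drop_append_of_le_length h2]
      simp [hS']
    obtain ⟨h1, h2⟩ := h.ready hU'
    exact ⟨fun r hr hf => h1 r hr ((h7 r (h.alloc r hr) (hext r hr)).2 hf),
      h2.congr (fun a ha => (h7 a (h.alloc a ha) (hext a ha)).1) fun a ha => (hn a ha).2⟩

theorem localInv (e : C.Evolve C') {lk : Addr → Option ℕ} {s : Local K}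
    (h : C.LocalInv lk s)
    (hn : ∀ a, s.newNode = some a → C'.Private a ∧ C'.heap a = C.heap a) :
    C'.LocalInv lk s := by
  cases s with
  | idle => trivial
  | loop _ => trivial
  | search _ _ _ => exact e.searchAt h
  | found _ _ _ => exact e.foundAt h
  | insR _ _ _ _ => exact ⟨e.seen _ h.1, e.hasKey h.2.1, e.linked h.2.2⟩
  | insP k _ _ _ _ =>
    exact ⟨e.foundAt h.1, e.exists_key (p := fun x => ekey k < x) h.2.1, e.linked h.2.2⟩
  | delP _ _ _ _ _ => exact ⟨e.foundAt h.1, e.linked h.2⟩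
  | delPR _ _ _ _ _ _ => exact ⟨e.foundAt h.1, e.linked h.2.1, e.linked h.2.2⟩
  | delNext _ _ _ _ _ _ =>
    obtain ⟨h1, h2, ⟨m, h3⟩, h4, h5⟩ := h
    exact ⟨e.foundAt h1, e.hasKey h2, ⟨m, e.linkSnap h3⟩, e.linkSnap h4, e.linked h5⟩
  | scx _ _ _ => exact e.pending h hn
  | scxDone _ => trivial

end Config.Evolve

namespace Config

variable {C : Config P K}

theorem Inv.seen_of_pointsTo (I : C.Inv) {r b : Addr} (hr : C.Seen r) (hb : C.PointsTo r b) :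
    C.Seen b := by
  rcases hr with h | h
  · exact .inl (h.tail hb)
  · exact I.seen_next r b h hb

theorem Inv.keyLt_of_pointsTo (I : C.Inv) {r b : Addr} (hb : C.PointsTo r b) :
    KeyLt C.heap r b := by
  obtain ⟨nd, h1, h2⟩ := hb
  obtain ⟨nb, h3, h4⟩ := I.increasing r nd b h1 h2
  exact ⟨nd, nb, h1, h3, h4⟩

theorem Inv.alloc_of_seen (I : C.Inv) {r : Addr} (hr : C.Seen r) : C.heap r ≠ none := by
  rcases hr with h | h
  · obtain ⟨l, hl⟩ := I.exists_seg
    obtain ⟨nd, hnd⟩ := hl.exists_node ((hl.inDS_iff r).1 h)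
    simp [hnd]
  · exact I.alloc r h

theorem Inv.linked_of_llx (I : C.Inv) {lk : Addr → Option ℕ} {r : Addr} {res : LlxResult}
    (hr : C.Seen r) (h : C.LlxReturns r res)
    (hlk : ∀ m nx, res = .snap m nx → lk r = some C.hist.length) : C.Linked lk r res := by
  rintro m nx rfl
  obtain ⟨h1, nd, h2, h3, h4⟩ := h
  refine ⟨_, hlk m nx rfl, le_rfl, by simp [h2], fun _ => ⟨h1, nd, h2, h3, h4⟩, ?_⟩
  rintro b rfl
  exact ⟨I.seen_of_pointsTo hr ⟨nd, h2, h4⟩, I.keyLt_of_pointsTo ⟨nd, h2, h4⟩⟩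

theorem LinkSnap.valid {lk : Addr → Option ℕ} {r : Addr} {m : ℕ} {nx : Option Addr}
    (h : C.LinkSnap lk r m nx) {S : Scx} (hr : r ∈ S.V) (hU : C.Unchanged S lk) :
    ¬ C.Finalized r ∧ ∃ nd, C.heap r = some nd ∧ nd.count = m ∧ nd.next = nx := by
  obtain ⟨n, h1, -, -, h4, -⟩ := h
  exact h4 (hU r hr n h1)

theorem LinkSnap.congr {lk lk' : Addr → Option ℕ} {r : Addr} {m : ℕ} {nx : Option Addr}
    (h : C.LinkSnap lk r m nx) (hlk : lk' r = lk r) : C.LinkSnap lk' r m nx := by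
  obtain ⟨n, h1, h2⟩ := h
  exact ⟨n, hlk.trans h1, h2⟩

theorem Linked.congr {lk lk' : Addr → Option ℕ} {r : Addr} {res : LlxResult}
    (h : C.Linked lk r res) (hlk : lk' r = lk r) : C.Linked lk' r res :=
  fun m nx hr => (h m nx hr).congr hlk

theorem LinkSnap.linked {lk : Addr → Option ℕ} {r : Addr} {m : ℕ} {nx : Option Addr}
    (h : C.LinkSnap lk r m nx) : ∃ n, lk r = some n ∧ n ≤ C.hist.length := by
  obtain ⟨n, h1, h2, -⟩ := h
  exact ⟨n, h1, h2⟩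

theorem LinkSnap.alloc {lk : Addr → Option ℕ} {r : Addr} {m : ℕ} {nx : Option Addr}
    (h : C.LinkSnap lk r m nx) : C.heap r ≠ none := by
  obtain ⟨n, -, -, h3, -⟩ := h
  exact h3

theorem LinkSnap.next {lk : Addr → Option ℕ} {r b : Addr} {m : ℕ}
    (h : C.LinkSnap lk r m (some b)) : C.Seen b ∧ KeyLt C.heap r b := by
  obtain ⟨n, -, -, -, -, h3⟩ := h
  exact h3 b rfl

theorem Inv.initial (P K : Type*) [LinearOrder K] : (Config.initial P K).Inv where
  head_key := ⟨_, rfl, rfl⟩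
  increasing := by
    intro a nd b ha hb
    simp only [Config.initial] at ha ⊢
    split_ifs at ha
    · cases ha
      cases hb
      exact ⟨_, rfl, by simp⟩
    · cases ha
      cases hb
  exists_seg := ⟨[head, tail], rfl, _, rfl, rfl, _, rfl, rfl⟩
  not_inDS := by simp [Config.Finalized, Config.initial]
  alloc := by simp [Config.Finalized, Config.initial]
  seen_next := by simp [Config.Finalized, Config.initial]
  loc := fun _ => trivial
  newNode_inj := by simp [Config.initial, Local.newNode]

theorem Inv.setLocal [DecidableEq P] (I : C.Inv) (q : P) {s : Local K} {lk : Addr → Option ℕ}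
    (hs : C.LocalInv lk s)
    (hn : ∀ a, s.newNode = some a → ∀ q', (C.loc q').newNode ≠ some a) :
    Inv { C with loc := Function.update C.loc q s, link := Function.update C.link q lk } where
  head_key := I.head_key
  increasing := I.increasing
  exists_seg := I.exists_seg
  not_inDS := I.not_inDS
  alloc := I.alloc
  seen_next := I.seen_next
  loc := by
    intro q'
    have e : C.Evolve
        { C with loc := Function.update C.loc q s, link := Function.update C.link q lk } :=
      .of_eq rfl rfl
    have hp : ∀ q' lk s', C.LocalInv lk s' → ∀ a, s'.newNode = some a → Config.Private
        { C with loc := Function.update C.loc q s, link := Function.update C.link q q' } a := by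
      intro q' lk s' h a ha
      cases s' <;> simp only [Local.newNode, reduceCtorEq] at ha
      exact (h.newNode a ha).1
    by_cases hq : q' = q
    · subst hq
      simp only [Function.update_self]
      exact e.localInv hs fun a ha => ⟨hp _ _ _ hs a ha, rfl⟩
    · simp only [Function.update_of_ne hq]
      exact e.localInv (I.loc q') fun a ha => ⟨hp _ _ _ (I.loc q') a ha, rfl⟩
  newNode_inj := by
    intro q₁ q₂ a h₁ h₂
    by_cases e₁ : q₁ = q <;> by_cases e₂ : q₂ = q
    · rw [e₁, e₂]
    · simp only [e₁, Function.update_self, Function.update_of_ne e₂] at h₁ h₂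
      exact (hn a h₁ q₂ h₂).elim
    · simp only [e₂, Function.update_self, Function.update_of_ne e₁] at h₁ h₂
      exact (hn a h₂ q₁ h₁).elim
    · simp only [Function.update_of_ne e₁, Function.update_of_ne e₂] at h₁ h₂
      exact I.newNode_inj q₁ q₂ a h₁ h₂

theorem Inv.goto [DecidableEq P] (I : C.Inv) (q : P) {s : Local K}
    (hs : C.LocalInv (C.link q) s) (hn : s.newNode = none) : (C.goto q s).Inv := by
  have := I.setLocal q hs (by simp [hn])
  rwa [Function.update_eq_self] at this

theorem Inv.llx [DecidableEq P] (I : C.Inv) (q : P) {r : Addr} {res : LlxResult} {s : Local K}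
    (hr : C.Seen r) (h : C.LlxReturns r res)
    (hs : ∀ lk, C.Linked lk r res → (∀ r', r' ≠ r → lk r' = C.link q r') → C.LocalInv lk s)
    (hn : s.newNode = none) : (C.llx q r res s).Inv := by
  refine I.setLocal q (hs _ (I.linked_of_llx hr h ?_) ?_) (by simp [hn])
  · rintro m nx rfl
    simp
  · exact fun r' hr' => Function.update_of_ne hr' _ _

theorem inDS_alloc {a : Addr} {nd : Node K} (ha : C.heap a = none) {r : Addr}
    (hr : C.InDS r) : (C.alloc a nd).InDS r := by
  refine Relation.ReflTransGen.mono (fun b c hbc => ?_) _ _ hr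
  obtain ⟨n, h1, h2⟩ := hbc
  refine ⟨n, ?_, h2⟩
  have : b ≠ a := by
    rintro rfl
    simp [ha] at h1
  simp [Config.alloc, this, h1]

theorem evolve_alloc {a : Addr} {nd : Node K} (ha : C.heap a = none) :
    C.Evolve (C.alloc a nd) := by
  have hne : ∀ b, C.heap b ≠ none → (C.alloc a nd).heap b = C.heap b := by
    intro b hb
    have : b ≠ a := by
      rintro rfl
      exact hb ha
    simp [Config.alloc, this]
  refine ⟨fun b n hb => ⟨n, by rw [hne b (by simp [hb]), hb], rfl⟩, ?_, [], by simp [Config.alloc],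
    fun b hb _ => ⟨hne b hb, id⟩⟩
  rintro r (hr | hr)
  · exact .inl (inDS_alloc ha hr)
  · exact .inr hr

theorem Inv.private_alloc (I : C.Inv) {a : Addr} {nd : Node K} (ha : C.heap a = none)
    (hnx : ∀ b, nd.next = some b → C.Seen b) {a' : Addr}
    (ha' : C.Private a' ∨ a' = a) : (C.alloc a nd).Private a' := by
  have hp : C.Private a' := by
    rcases ha' with h | rfl
    · exact h
    · refine ⟨?_, fun h => I.alloc _ h ha, fun b hb => ?_⟩
      · rintro rfl
        obtain ⟨n, hn, -⟩ := I.head_key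
        simp [ha] at hn
      · obtain ⟨n, h1, h2⟩ := hb
        obtain ⟨n', h3, -⟩ := I.increasing _ _ _ h1 h2
        simp [ha] at h3
  refine ⟨hp.1, hp.2.1, ?_⟩
  rintro b ⟨n, h1, h2⟩
  by_cases hb : b = a
  · subst hb
    simp only [Config.alloc, Function.update_self, Option.some.injEq] at h1
    subst h1
    exact hp.not_seen (hnx _ h2)
  · simp only [Config.alloc, Function.update_of_ne hb] at h1
    exact hp.2.2 b ⟨n, h1, h2⟩

theorem seg_alloc {l : List Addr} {a : Addr} {nd : Node K}
    (ha : C.heap a = none) (hl : Seg C.heap (some head) l none) :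
    Seg (C.alloc a nd).heap (some head) l none := by
  refine hl.congr fun b hb => ?_
  have : b ≠ a := by
    rintro rfl
    obtain ⟨n, hn⟩ := hl.exists_node hb
    simp [ha] at hn
  simp [Config.alloc, this]

theorem Inv.newNode_private (I : C.Inv) {q : P} {a : Addr} (h : (C.loc q).newNode = some a) :
    C.Private a ∧ C.heap a ≠ none := by
  have := I.loc q
  cases hl : C.loc q <;> simp only [hl, Local.newNode, reduceCtorEq] at h
  rw [hl] at this
  exact this.newNode a h

theorem Inv.alloc_new (I : C.Inv) {a : Addr} {nd : Node K} (ha : C.heap a = none)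
    (hnx : ∀ b, nd.next = some b → C.Seen b ∧ ∃ nb, C.heap b = some nb ∧ nd.key < nb.key) :
    (C.alloc a nd).Inv := by
  have e : C.Evolve (C.alloc a nd) := evolve_alloc ha
  obtain ⟨l, hl⟩ := I.exists_seg
  have hl' := seg_alloc (nd := nd) ha hl
  refine ⟨e.hasKey I.head_key, ?_, ⟨l, hl'⟩, ?_, fun r hr => e.alloc_ne (I.alloc r hr), ?_, ?_,
    I.newNode_inj⟩
  · intro b n c hb hc
    by_cases hba : b = a
    · subst hba
      simp only [Config.alloc, Function.update_self, Option.some.injEq] at hb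
      subst hb
      exact e.exists_key (p := fun x => nd.key < x) (hnx c hc).2
    · simp only [Config.alloc, Function.update_of_ne hba] at hb
      exact e.exists_key (p := fun x => n.key < x) (I.increasing b n c hb hc)
  · intro r hr hin
    exact I.not_inDS r hr ((hl.inDS_iff r).2 ((hl'.inDS_iff r).1 hin))
  · rintro r b hr ⟨n, h1, h2⟩
    have : r ≠ a := by
      rintro rfl
      exact I.alloc _ hr ha
    simp only [Config.alloc, Function.update_of_ne this] at h1
    exact e.seen b (I.seen_next r b hr ⟨n, h1, h2⟩)
  · intro q
    refine e.localInv (I.loc q) fun a' ha' => ?_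
    obtain ⟨h1, h2⟩ := I.newNode_private ha'
    refine ⟨I.private_alloc ha (fun b hb => (hnx b hb).1) (.inl h1), ?_⟩
    have : a' ≠ a := by
      rintro rfl
      exact h2 ha
    simp [Config.alloc, this]

theorem Inv.invokeScx [DecidableEq P] (I : C.Inv) (q : P) {o : Op K} {S : Scx}
    (h : C.Pending o S (C.link q))
    (hn : ∀ a, S.upd.newNode = some a → ∀ q', (C.loc q').newNode ≠ some a) :
    (C.invokeScx q o S).Inv :=
  I.setLocal q h hn

/-- Allocating the new node and invoking the SCX that inserts it. -/
theorem Inv.alloc_invokeScx [DecidableEq P] (I : C.Inv) {q : P} {o : Op K} {p a : Addr}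
    {mid : List Addr} {nd : Node K} (ha : C.heap a = none)
    (hnx : ∀ b, nd.next = some b → C.Seen b ∧ ∃ nb, C.heap b = some nb ∧ nd.key < nb.key)
    (hV : ∀ r ∈ p :: mid, C.Seen r ∧ ∃ m nx, C.LinkSnap (C.link q) r m nx)
    (hready : (C.alloc a nd).Inv →
      (C.alloc a nd).Unchanged ⟨p :: mid, mid, .next p a⟩ (C.link q) →
      Ready (C.alloc a nd).heap o ⟨p :: mid, mid, .next p a⟩) :
    ((C.alloc a nd).invokeScx q o ⟨p :: mid, mid, .next p a⟩).Inv := by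
  have I' := I.alloc_new ha hnx
  have e : C.Evolve (C.alloc a nd) := evolve_alloc ha
  refine I'.invokeScx q ⟨fun r hr => e.seen r (hV r hr).1, ?_, ?_, ?_, fun hU => ⟨?_, hready I' hU⟩⟩
    ?_
  · intro r hr
    obtain ⟨-, m, nx, h⟩ := hV r hr
    exact e.alloc_ne h.alloc
  · intro r hr
    obtain ⟨-, m, nx, h⟩ := hV r hr
    exact h.linked
  · rintro a' ha'
    cases ha'
    exact ⟨I.private_alloc ha (fun b hb => (hnx b hb).1) (.inr rfl), by simp [Config.alloc]⟩
  · intro r hr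
    obtain ⟨-, m, nx, h⟩ := hV r hr
    exact ((e.linkSnap h).valid hr hU).1
  · rintro a' ha' q' hq'
    cases ha'
    exact (I.newNode_private hq').2 ha

/-! ### Linearization of an SCX -/

theorem Inv.inDS_of_scx (I : C.Inv) {q : P} {o : Op K} {S : Scx} {lk : Addr → Option ℕ}
    (hl : C.loc q = .scx o S lk) (hU : C.Unchanged S lk) {r : Addr} (hr : r ∈ S.V) :
    C.InDS r := by
  have hp := I.loc q
  rw [hl] at hp
  exact (hp.seen r hr).resolve_right ((hp.ready hU).1 r hr)

theorem Inv.ready_of_scx (I : C.Inv) {q : P} {o : Op K} {S : Scx} {lk : Addr → Option ℕ}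
    (hl : C.loc q = .scx o S lk) (hU : C.Unchanged S lk) : Ready C.heap o S := by
  have hp := I.loc q
  rw [hl] at hp
  exact (hp.ready hU).2

variable [DecidableEq P]

theorem finalized_linearizeScx {q : P} {o : Op K} {S : Scx} {r : Addr} :
    (C.linearizeScx q o S).Finalized r ↔ C.Finalized r ∨ r ∈ S.R := by
  simp [Config.Finalized, Config.linearizeScx, or_and_right, exists_or]

theorem Inv.exists_seg_linearizeScx (I : C.Inv) {q : P} {o : Op K} {S : Scx}
    {lk : Addr → Option ℕ} (hq : C.loc q = .scx o S lk) (hU : C.Unchanged S lk) {l : List Addr}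
    (hl : Seg C.heap (some head) l none) :
    ∃ l', Seg (C.linearizeScx q o S).heap (some head) l' none ∧
      (∀ x, x ∈ l' ↔ (x ∈ l ∧ x ∉ S.R) ∨ S.upd.newNode = some x) ∧
      ∀ k, o.Effect k (total C.heap k l) (total (C.linearizeScx q o S).heap k l') := by
  refine (I.ready_of_scx hq hU).exists_seg I.increasing hl
    (fun r hr => (hl.inDS_iff r).1 (I.inDS_of_scx hq hU hr)) fun a ha hal => ?_
  have : (C.loc q).newNode = some a := by rw [hq]; exact ha
  exact (I.newNode_private this).1.not_seen (.inl ((hl.inDS_iff a).2 hal))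

theorem Inv.evolve_linearizeScx (I : C.Inv) {q : P} {o : Op K} {S : Scx}
    {lk : Addr → Option ℕ} (hq : C.loc q = .scx o S lk) (hU : C.Unchanged S lk) :
    C.Evolve (C.linearizeScx q o S) := by
  obtain ⟨l, hl⟩ := I.exists_seg
  obtain ⟨l', hl', hmem, -⟩ := I.exists_seg_linearizeScx hq hU hl
  have hr := I.ready_of_scx hq hU
  refine ⟨fun a nd ha => Update.apply_key ha, fun r h => ?_, [S], rfl, fun a _ ha => ⟨?_, ?_⟩⟩
  · by_cases hR : r ∈ S.R
    · exact .inr (finalized_linearizeScx.2 (.inr hR))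
    · rcases h with h | h
      · exact .inl ((hl'.inDS_iff r).2 ((hmem r).2 (.inl ⟨(hl.inDS_iff r).1 h, hR⟩)))
      · exact .inr (finalized_linearizeScx.2 (.inl h))
  · refine Update.apply_of_ne ?_
    rintro rfl
    exact ha S (by simp) hr.target_mem
  · intro hf
    refine (finalized_linearizeScx.1 hf).resolve_right fun hR => ha S (by simp) (hr.subset hR)

theorem Inv.linearizeScx (I : C.Inv) {q : P} {o : Op K} {S : Scx}
    {lk : Addr → Option ℕ} (hq : C.loc q = .scx o S lk) (hU : C.Unchanged S lk) :
    (C.linearizeScx q o S).Inv := by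
  have e := I.evolve_linearizeScx hq hU
  obtain ⟨l, hl⟩ := I.exists_seg
  obtain ⟨l', hl', hmem, -⟩ := I.exists_seg_linearizeScx hq hU hl
  have hr := I.ready_of_scx hq hU
  have hin := fun r hr => I.inDS_of_scx hq hU (r := r) hr
  have hnew : ∀ a, S.upd.newNode = some a → (C.loc q).newNode = some a := by
    intro a ha
    rw [hq]
    exact ha
  have hfin : ∀ r, (C.linearizeScx q o S).Finalized r → C.Seen r ∧ r ≠ S.upd.target := by
    intro r h
    rcases finalized_linearizeScx.1 h with h | h
    · refine ⟨.inr h, ?_⟩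
      rintro rfl
      exact I.not_inDS _ h (hin _ hr.target_mem)
    · refine ⟨.inl (hin _ (hr.subset h)), ?_⟩
      rintro rfl
      exact hr.target_notMem I.increasing h
  refine ⟨e.hasKey I.head_key, hr.increasing_apply I.increasing, ⟨l', hl'⟩, ?_,
    fun r h => e.alloc_ne (I.alloc_of_seen (hfin r h).1), ?_, ?_, ?_⟩
  · intro r h hin'
    rcases (hmem r).1 ((hl'.inDS_iff r).1 hin') with ⟨h1, h2⟩ | h1
    · rcases finalized_linearizeScx.1 h with h | h
      · exact I.not_inDS r h ((hl.inDS_iff r).2 h1)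
      · exact h2 h
    · exact (I.newNode_private (hnew r h1)).1.not_seen (hfin r h).1
  · rintro r b h ⟨n, h1, h2⟩
    obtain ⟨h3, h4⟩ := hfin r h
    have h1' : C.heap r = some n := by rw [← h1]; exact (Update.apply_of_ne h4).symm
    exact e.seen b (I.seen_of_pointsTo h3 ⟨n, h1', h2⟩)
  · intro q'
    by_cases hqq : q' = q
    · subst hqq
      simp only [Config.linearizeScx, Function.update_self]
      trivial
    · have h1 : (C.linearizeScx q o S).loc q' = C.loc q' := Function.update_of_ne hqq _ _
      rw [h1]
      refine e.localInv (I.loc q') fun a ha => ?_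
      obtain ⟨hp, -⟩ := I.newNode_private ha
      refine ⟨⟨hp.1, fun hf => hp.not_seen (hfin a hf).1, ?_⟩, Update.apply_of_ne ?_⟩
      · rintro b ⟨n, h2, h3⟩
        obtain ⟨n0, h4, -, h5 | ⟨h5, -⟩⟩ := hr.next_apply h2 h3
        · exact hp.2.2 b ⟨n0, h4, h5⟩
        · exact hqq (I.newNode_inj q' q a ha (hnew a h5))
      · rintro rfl
        exact hp.not_seen (.inl (hin _ hr.target_mem))
  · have key : ∀ q₁ a, ((C.linearizeScx q o S).loc q₁).newNode = some a →
        (C.loc q₁).newNode = some a := by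
      intro q₁ a h
      by_cases e₁ : q₁ = q
      · subst e₁
        simp [Config.linearizeScx, Local.newNode] at h
      · simpa only [Config.linearizeScx, Function.update_of_ne e₁] using h
    exact fun q₁ q₂ a h₁ h₂ => I.newNode_inj q₁ q₂ a (key q₁ a h₁) (key q₂ a h₂)

theorem Inv.isKeyMultiset_linearizeScx (I : C.Inv) {q : P} {o : Op K} {S : Scx}
    {lk : Addr → Option ℕ} (hq : C.loc q = .scx o S lk) (hU : C.Unchanged S lk)
    {σ : Multiset K} (h : C.IsKeyMultiset σ) :
    (C.linearizeScx q o S).IsKeyMultiset (o.exec σ) := by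
  obtain ⟨l, hl⟩ := I.exists_seg
  obtain ⟨l', hl', -, heff⟩ := I.exists_seg_linearizeScx hq hU hl
  rw [isKeyMultiset_iff I.increasing hl] at h
  rw [isKeyMultiset_iff (I.linearizeScx hq hU).increasing hl']
  refine Op.Effect.count_exec fun k => ?_
  rw [← h k]
  exact heff k

end Config

end Invariance

/-! ### Steps -/

section Steps

variable {P K : Type*} [DecidableEq P] [LinearOrder K] {C C' : Config P K} {q : P} {a : Action K}

theorem occ_of_heap {h : Addr → Option (Node K)} {b : Addr} {nd : Node K} (hb : h b = some nd)
    (k : K) : occ h k b = if nd.key = ekey k then nd.count else 0 := by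
  simp [occ, hb]

theorem ekey_inj {k k' : K} : ekey k = ekey k' ↔ k = k' := by
  simp [ekey]

theorem Step.inv (h : Step C q a C') (I : C.Inv) : C'.Inv := by
  have hloc := I.loc q
  cases h with
  | invoke o h1 h2 => exact I.goto q trivial rfl
  | searchBegin h1 h2 =>
    have hs : C.Seen head := .inl .refl
    refine I.goto q ⟨hs, I.seen_of_pointsTo hs h2, I.keyLt_of_pointsTo h2, ?_⟩ rfl
    obtain ⟨nd, h3, h4⟩ := I.head_key
    exact ⟨nd, h3, by rw [h4]; exact WithBot.bot_lt_coe _⟩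
  | searchAdvance h1 h2 h3 h4 =>
    rw [h1] at hloc
    obtain ⟨nd, h5, rfl⟩ := h2
    exact I.goto q ⟨hloc.seen_right, I.seen_of_pointsTo hloc.seen_right h4,
      I.keyLt_of_pointsTo h4, nd, h5, h3⟩ rfl
  | searchReturn h1 h2 h3 =>
    rw [h1] at hloc
    obtain ⟨nd, h5, rfl⟩ := h2
    exact I.goto q ⟨hloc, nd, h5, h3⟩ rfl
  | getPresent h1 h2 h3 => exact I.goto q trivial rfl
  | getAbsent h1 h2 h3 => exact I.goto q trivial rfl
  | insLlxR h1 h2 h3 =>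
    rw [h1] at hloc
    exact I.llx q hloc.seen_right h3 (fun lk hlk _ => ⟨hloc.seen_right, h2, hlk⟩) rfl
  | insRestartR h1 h2 => exact I.goto q trivial rfl
  | @insScxR k c r m n h1 =>
    rw [h1] at hloc
    obtain ⟨h2, h3, h4⟩ := hloc
    have h5 := h4 m n rfl
    refine I.invokeScx q ⟨?_, ?_, ?_, by simp [Update.newNode], fun hU => ?_⟩
      (by simp [Update.newNode])
    · simpa using h2
    · simpa using h5.alloc
    · simpa using h5.linked
    · obtain ⟨h6, nd, h7, rfl, -⟩ := h5.valid (by simp) hU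
      obtain ⟨nd', h8, h9⟩ := h3
      rw [h7] at h8
      cases h8
      exact ⟨by simpa using h6, .count h7 h9⟩
  | insLlxP h1 h2 h3 h4 =>
    rw [h1] at hloc
    obtain ⟨nd, h5, h6⟩ := hloc.le_right
    obtain ⟨nd', h7, rfl⟩ := h2
    rw [h5] at h7
    cases h7
    exact I.llx q hloc.seen_left h4
      (fun lk hlk _ => ⟨hloc, ⟨nd, h5, lt_of_le_of_ne h6 h3.symm⟩, hlk⟩) rfl
  | insRestartP h1 h2 => exact I.goto q trivial rfl
  | @insScxP k c p r m b h1 h2 =>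
    rw [h1] at hloc
    obtain ⟨hf, h3, h4⟩ := hloc
    have h5 := h4 m _ rfl
    refine I.alloc_invokeScx h2 ?_ ?_ fun I' hU => ?_
    · rintro b' hb'
      cases hb'
      exact ⟨hf.seen_right, h3⟩
    · rintro r' hr'
      cases List.mem_singleton.1 hr'
      exact ⟨hf.seen_left, _, _, h5⟩
    · have e := Config.evolve_alloc (nd := ⟨ekey k, c, some r⟩) h2
      obtain ⟨-, nd, h6, -, h7⟩ := (e.linkSnap h5).valid (by simp) hU
      have h8 : (C.alloc b ⟨ekey k, c, some r⟩).heap b = some ⟨ekey k, c, some r⟩ := by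
        simp [Config.alloc]
      refine .splice h6 h8 ?_ h7 fun k' => ?_
      · obtain ⟨nd', h9, h10⟩ := e.exists_key (p := fun x => x < ekey k) hf.left_lt
        rw [h6] at h9
        cases h9
        exact h10
      · rw [occ_of_heap h8]
        simp [Op.Effect, total_nil, Multiset.count_replicate, ekey_inj]
  | delLlxP h1 h2 =>
    rw [h1] at hloc
    exact I.llx q hloc.seen_left h2 (fun lk hlk _ => ⟨hloc, hlk⟩) rfl
  | delLlxR h1 h2 =>
    rw [h1] at hloc
    obtain ⟨hf, h3⟩ := hloc
    exact I.llx q hf.seen_right h2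
      (fun lk hlk hlk' => ⟨hf, h3.congr (hlk' _ hf.keyLt.ne), hlk⟩) rfl
  | delRestart h1 h2 => exact I.goto q trivial rfl
  | delFalse h1 h2 h3 => exact I.goto q trivial rfl
  | @delScxMore k c p r mp mr n b h1 h2 h3 h4 =>
    rw [h1] at hloc
    obtain ⟨hf, hp, hr⟩ := hloc
    have hp := hp _ _ rfl
    have hr := hr _ _ rfl
    refine I.alloc_invokeScx h4 ?_ ?_ fun I' hU => ?_
    · rintro b' rfl
      obtain ⟨h5, nr, nb, h6, h7, h8⟩ := hr.next
      obtain ⟨nr', h9, h10⟩ := h2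
      rw [h6] at h9
      cases h9
      rw [h10] at h8
      exact ⟨h5, nb, h7, h8⟩
    · intro r' hr'
      simp only [List.mem_cons, List.not_mem_nil, or_false] at hr'
      rcases hr' with rfl | rfl
      · exact ⟨hf.seen_left, _, _, hp⟩
      · exact ⟨hf.seen_right, _, _, hr⟩
    · have e := Config.evolve_alloc (nd := ⟨ekey k, mr - c, n⟩) h4
      obtain ⟨-, np, h6, -, h7⟩ := (e.linkSnap hp).valid (by simp) hU
      obtain ⟨-, nr, h8, h9, h10⟩ := (e.linkSnap hr).valid (by simp) hU
      have h11 : (C.alloc b ⟨ekey k, mr - c, n⟩).heap b = some ⟨ekey k, mr - c, n⟩ := by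
        simp [Config.alloc]
      refine .splice h6 h11 ?_ ⟨h7, nr, h8, h10⟩ fun k' => ?_
      · obtain ⟨nd', h9, h10⟩ := e.exists_key (p := fun x => x < ekey k) hf.left_lt
        rw [h6] at h9
        cases h9
        exact h10
      · obtain ⟨nr', h12, h13⟩ := e.hasKey h2
        rw [h8] at h12
        cases h12
        rw [occ_of_heap h11, total_cons, total_nil, occ_of_heap h8]
        simp only [Op.Effect, Multiset.count_replicate, ekey_inj, h13, h9]
        split_ifs <;> omega
  | delLlxNext h1 h2 h3 h4 =>
    rw [h1] at hloc
    subst h3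
    obtain ⟨hf, hp, hr⟩ := hloc
    have hp := hp _ _ rfl
    have hr := hr _ _ rfl
    have h5 := hr.next
    exact I.llx q h5.1 h4 (fun lk hlk hlk' => ⟨hf, h2,
      ⟨_, hp.congr (hlk' _ (hf.keyLt.trans h5.2).ne)⟩, hr.congr (hlk' _ h5.2.ne), hlk⟩) rfl
  | delRestartNext h1 h2 => exact I.goto q trivial rfl
  | @delScxAll k c p r rnext x m n b h1 h2 h3 =>
    rw [h1] at hloc
    obtain ⟨hf, hk, ⟨mp, hp⟩, hr, hn⟩ := hloc
    have hn := hn _ _ rfl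
    refine I.alloc_invokeScx h3 ?_ ?_ fun I' hU => ?_
    · rintro b' rfl
      obtain ⟨h5, nr, nb, h6, h7, h8⟩ := hn.next
      obtain ⟨nr', h9, h10⟩ := h2
      rw [h6] at h9
      cases h9
      rw [h10] at h8
      exact ⟨h5, nb, h7, h8⟩
    · intro r' hr'
      simp only [List.mem_cons, List.not_mem_nil, or_false] at hr'
      rcases hr' with rfl | rfl | rfl
      · exact ⟨hf.seen_left, _, _, hp⟩
      · exact ⟨hf.seen_right, _, _, hr⟩
      · exact ⟨hr.next.1, _, _, hn⟩
    · have e := Config.evolve_alloc (nd := ⟨x, m, n⟩) h3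
      obtain ⟨-, np, h6, -, h7⟩ := (e.linkSnap hp).valid (by simp) hU
      obtain ⟨-, nr, h8, h9, h10⟩ := (e.linkSnap hr).valid (by simp) hU
      obtain ⟨-, nn, h14, h15, h16⟩ := (e.linkSnap hn).valid (by simp) hU
      have h11 : (C.alloc b ⟨x, m, n⟩).heap b = some ⟨x, m, n⟩ := by
        simp [Config.alloc]
      obtain ⟨nn', h17, h18⟩ := e.hasKey h2
      rw [h14] at h17
      cases h17
      refine .splice h6 h11 ?_ ⟨h7, nr, h8, h10, nn, h14, h16⟩ fun k' => ?_
      · obtain ⟨a1, a2, h19, h20, h21⟩ := (e.keyLt hf.keyLt).trans (e.keyLt hr.next.2)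
        rw [h6] at h19
        rw [h14] at h20
        cases h19
        cases h20
        rw [h18] at h21
        exact h21
      · obtain ⟨nr', h12, h13⟩ := e.hasKey hk
        rw [h8] at h12
        cases h12
        rw [occ_of_heap h11, total_cons, total_cons, total_nil, occ_of_heap h8, occ_of_heap h14]
        simp only [Op.Effect, Multiset.count_replicate, ekey_inj, h13, h9, h18, h15]
        split_ifs <;> omega
  | scxLinearize h1 h2 => exact I.linearizeScx h1 h2
  | scxFalse h1 => exact I.goto q trivial rfl
  | insReturn h1 => exact I.goto q trivial rfl
  | delReturn h1 => exact I.goto q trivial rfl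

/-- A step does not change the local states of the other processes. -/
theorem Step.loc_of_ne (h : Step C q a C') {q' : P} (hq : q' ≠ q) : C'.loc q' = C.loc q' := by
  cases h <;> exact Function.update_of_ne hq _ _

/-- Either a step linearizes an SCX, or it can only create a new node. -/
theorem Step.cases_shared (h : Step C q a C') :
    (a ≠ .scxLinearize ∧ C'.hist = C.hist ∧ ∀ b, C.heap b ≠ none → C'.heap b = C.heap b) ∨
      (a = .scxLinearize ∧ ∃ o S lk, C.loc q = .scx o S lk ∧ C.Unchanged S lk ∧
        C' = C.linearizeScx q o S) := by
  have key : ∀ (x : Addr) (nd : Node K), C.heap x = none → ∀ b, C.heap b ≠ none →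
      (C.alloc x nd).heap b = C.heap b := by
    intro x nd hx b hb
    have : b ≠ x := by
      rintro rfl
      exact hb hx
    simp [Config.alloc, this]
  cases h with
  | insScxP h1 h2 => exact .inl ⟨by simp, rfl, key _ _ h2⟩
  | delScxMore h1 h2 h3 h4 => exact .inl ⟨by simp, rfl, key _ _ h4⟩
  | delScxAll h1 h2 h3 => exact .inl ⟨by simp, rfl, key _ _ h3⟩
  | scxLinearize h1 h2 => exact .inr ⟨rfl, _, _, _, h1, h2, rfl⟩
  | _ => exact .inl ⟨by simp, rfl, fun _ _ => rfl⟩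

theorem seg_of_heap_eq {l : List Addr} (hl : Seg C.heap (some head) l none)
    (hh : ∀ b, C.heap b ≠ none → C'.heap b = C.heap b) : Seg C'.heap (some head) l none := by
  refine hl.congr fun b hb => hh b ?_
  obtain ⟨nd, hnd⟩ := hl.exists_node hb
  simp [hnd]

theorem Step.hasKey (h : Step C q a C') (I : C.Inv) {r : Addr} {x : EKey K}
    (hr : C.HasKey r x) : C'.HasKey r x := by
  rcases h.cases_shared with ⟨-, -, hh⟩ | ⟨-, o, S, lk, h1, h2, rfl⟩
  · obtain ⟨nd, h1, h2⟩ := hr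
    exact ⟨nd, by rw [hh r (by simp [h1]), h1], h2⟩
  · exact (I.evolve_linearizeScx h1 h2).hasKey hr

/-- A node that is, or was, in the data structure is in it after the step, or it does not
change. -/
theorem Step.seen (h : Step C q a C') (I : C.Inv) {r : Addr} (hr : C.Seen r) :
    C'.InDS r ∨ (C'.heap r = C.heap r ∧ C'.Seen r) := by
  rcases h.cases_shared with ⟨-, hh, hh'⟩ | ⟨-, o, S, lk, h1, h2, rfl⟩
  · rcases hr with hr | hr
    · obtain ⟨l, hl⟩ := I.exists_seg
      exact .inl (((seg_of_heap_eq hl hh').inDS_iff r).2 ((hl.inDS_iff r).1 hr))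
    · exact .inr ⟨hh' r (I.alloc r hr), .inr ((Config.finalized_congr hh r).2 hr)⟩
  · rcases (I.evolve_linearizeScx h1 h2).seen r hr with hr' | hr'
    · exact .inl hr'
    · refine .inr ⟨Update.apply_of_ne ?_, .inr hr'⟩
      rintro rfl
      have hR := I.ready_of_scx h1 h2
      rcases Config.finalized_linearizeScx.1 hr' with hr' | hr'
      · exact I.not_inDS _ hr' (I.inDS_of_scx h1 h2 hR.target_mem)
      · exact hR.target_notMem I.increasing hr'

theorem Step.isKeyMultiset (h : Step C q a C') (I : C.Inv) (ha : a ≠ .scxLinearize)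
    {σ : Multiset K} (hσ : C.IsKeyMultiset σ) : C'.IsKeyMultiset σ := by
  obtain ⟨-, -, hh⟩ := h.cases_shared.resolve_right fun h => ha h.1
  obtain ⟨l, hl⟩ := I.exists_seg
  rw [isKeyMultiset_iff I.increasing hl] at hσ
  rw [isKeyMultiset_iff (h.inv I).increasing (seg_of_heap_eq hl hh)]
  intro k
  rw [← hσ k]
  refine total_congr (fun b hb => hh b ?_) k
  obtain ⟨nd, hnd⟩ := hl.exists_node hb
  simp [hnd]

end Steps

/-! ### Executions -/

/-- The operation in progress. -/
def Local.op {K : Type*} : Local K → Option (Op K)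
  | .idle => none
  | .loop o => some o
  | .search o _ _ => some o
  | .found o _ _ => some o
  | .insR k c _ _ => some (.insert k c)
  | .insP k c _ _ _ => some (.insert k c)
  | .delP k c _ _ _ => some (.delete k c)
  | .delPR k c _ _ _ _ => some (.delete k c)
  | .delNext k c _ _ _ _ => some (.delete k c)
  | .scx o _ _ => some o
  | .scxDone o => some o

/-- The operation will not take a step other than its return. -/
def Local.Ended {K : Type*} : Local K → Prop
  | .idle => True
  | .scxDone _ => True
  | _ => False

section Inversion

variable {P K : Type*} [DecidableEq P] [LinearOrder K] {C C' : Config P K} {q : P} {a : Action K}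

theorem Step.op (h : Step C q a C') {o : Op K} (ho : (C'.loc q).op = some o) :
    a = .invoke o ∨ (∀ o', a ≠ .invoke o') ∧ (C.loc q).op = some o := by
  cases h <;> simp_all [Config.goto, Config.llx, Config.invokeScx, Config.linearizeScx,
    Config.alloc, Local.op]

theorem Step.invoke_inv {o : Op K} (h : Step C q (.invoke o) C') :
    C.loc q = .idle ∧ o.Valid := by
  cases h
  exact ⟨‹_›, ‹_›⟩

theorem Step.not_idle (h : Step C q a C') (ha : ∀ o, a ≠ .invoke o) : C.loc q ≠ .idle := by
  cases h <;> simp_all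

theorem Step.ended (h : Step C q a C') (he : (C.loc q).Ended) (ha : ∀ o, a ≠ .invoke o) :
    (C'.loc q).Ended := by
  cases h <;> simp_all [Config.goto, Local.Ended]

theorem Step.to_search (h : Step C q a C') {o : Op K} {p r : Addr}
    (hl : C'.loc q = .search o p r) :
    (a = .searchBegin ∧ p = head ∧ C.PointsTo head r) ∨
      (a = .searchAdvance ∧ ∃ p', C.loc q = .search o p' p ∧ C.PointsTo p r) := by
  cases h <;> simp_all [Config.goto, Config.llx, Config.invokeScx, Config.linearizeScx,
    Config.alloc]

theorem Step.to_found (h : Step C q a C') {o : Op K} {p r : Addr}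
    (hl : C'.loc q = .found o p r) : a = .searchReturn ∧ C.loc q = .search o p r := by
  cases h <;> simp_all [Config.goto, Config.llx, Config.invokeScx, Config.linearizeScx,
    Config.alloc]

theorem Step.to_delP (h : Step C q a C') {k : K} {c : ℕ} {p r : Addr} {lp : LlxResult}
    (hl : C'.loc q = .delP k c p r lp) : a = .llx p ∧ C.loc q = .found (.delete k c) p r := by
  cases h <;> simp_all [Config.goto, Config.llx, Config.invokeScx, Config.linearizeScx,
    Config.alloc]

theorem Step.to_delPR (h : Step C q a C') {k : K} {c : ℕ} {p r : Addr} {lp lr : LlxResult}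
    (hl : C'.loc q = .delPR k c p r lp lr) :
    a = .llx r ∧ C.loc q = .delP k c p r lp ∧ C.LlxReturns r lr := by
  cases h <;> simp_all [Config.goto, Config.llx, Config.invokeScx, Config.linearizeScx,
    Config.alloc]

theorem Step.to_scxDone (h : Step C q a C') {o : Op K} (hl : C'.loc q = .scxDone o) :
    a = .scxLinearize := by
  cases h <;> simp_all [Config.goto, Config.llx, Config.invokeScx, Config.linearizeScx,
    Config.alloc]

theorem Step.linearize_inv (h : Step C q .scxLinearize C') :
    ∃ o S lk, C.loc q = .scx o S lk ∧ C.Unchanged S lk ∧ C' = C.linearizeScx q o S := by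
  cases h
  exact ⟨_, _, _, ‹_›, ‹_›, rfl⟩

theorem Step.ret_idle {v : Resp} (h : Step C q (.ret v) C') : C'.loc q = .idle := by
  cases h <;> simp [Config.goto]

theorem Step.ret_inv {v : Resp} (h : Step C q (.ret v) C') :
    (∃ k p r n, C.loc q = .found (.get k) p r ∧ v = .num n ∧
        C.HasKey r (ekey k) ∧ C.HasCount r n) ∨
      (∃ k p r x n, C.loc q = .found (.get k) p r ∧ v = .num n ∧ C.HasKey r x ∧ x ≠ ekey k) ∨
      (∃ k c p r x lp mr n, C.loc q = .delPR k c p r lp (.snap mr n) ∧ v = .bool false ∧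
        C.HasKey r x ∧ (x ≠ ekey k ∨ mr < c)) ∨
      ∃ o, C.loc q = .scxDone o := by
  cases h with
  | getPresent h1 h2 h3 => exact .inl ⟨_, _, _, _, h1, rfl, h2, h3⟩
  | getAbsent h1 h2 h3 => exact .inr (.inl ⟨_, _, _, _, _, h1, rfl, h2, h3⟩)
  | delFalse h1 h2 h3 => exact .inr (.inr (.inl ⟨_, _, _, _, _, _, _, _, h1, rfl, h2, h3⟩))
  | insReturn h1 => exact .inr (.inr (.inr ⟨_, h1⟩))
  | delReturn h1 => exact .inr (.inr (.inr ⟨_, h1⟩))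

end Inversion

namespace Execution

variable {P K : Type*} [DecidableEq P] [LinearOrder K] (E : Execution P K)

theorem inv (t : ℕ) : (E.conf t).Inv := by
  induction t with
  | zero =>
    rw [E.init]
    exact .initial P K
  | succ t ih =>
    cases ha : E.act t with
    | none => rwa [E.idle t ha]
    | some x => exact (E.step t x.1 x.2 ha).inv ih

theorem loc_succ {t : ℕ} {q : P} (h : ∀ a, E.act t ≠ some (q, a)) :
    (E.conf (t + 1)).loc q = (E.conf t).loc q := by
  cases ha : E.act t with
  | none => rw [E.idle t ha]
  | some x =>
    refine (E.step t x.1 x.2 ha).loc_of_ne ?_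
    rintro rfl
    exact h x.2 ha

theorem hasKey_mono {t t' : ℕ} (ht : t ≤ t') {r : Addr} {x : EKey K}
    (h : (E.conf t).HasKey r x) : (E.conf t').HasKey r x := by
  induction t', ht using Nat.le_induction with
  | base => exact h
  | succ u _ ih =>
    cases ha : E.act u with
    | none => rwa [E.idle u ha]
    | some y => exact (E.step u y.1 y.2 ha).hasKey (E.inv u) ih

/-- The contents of a node that was in the data structure are those at some time since when it was
in the data structure. -/
theorem exists_inDS {t t' : ℕ} (ht : t ≤ t') {r : Addr} (h : (E.conf t).InDS r) :
    ∃ j, t ≤ j ∧ j ≤ t' ∧ (E.conf j).InDS r ∧ (E.conf j).heap r = (E.conf t').heap r := by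
  suffices (E.conf t').Seen r ∧ ∃ j, t ≤ j ∧ j ≤ t' ∧ (E.conf j).InDS r ∧
    (E.conf j).heap r = (E.conf t').heap r from this.2
  induction t', ht using Nat.le_induction with
  | base => exact ⟨.inl h, t, le_rfl, le_rfl, h, rfl⟩
  | succ t' ht ih =>
    obtain ⟨hs, j, h1, h2, h3, h4⟩ := ih
    cases ha : E.act t' with
    | none =>
      rw [E.idle t' ha]
      exact ⟨hs, j, h1, by omega, h3, h4⟩
    | some x =>
      rcases (E.step t' x.1 x.2 ha).seen (E.inv t') hs with h5 | ⟨h5, h6⟩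
      · exact ⟨.inl h5, t' + 1, by omega, le_rfl, h5, rfl⟩
      · exact ⟨h6, j, h1, by omega, h3, h4.trans h5.symm⟩

/-- Every process that is not idle has taken a last step. -/
theorem exists_last {t : ℕ} {q : P} (h : (E.conf t).loc q ≠ .idle) :
    ∃ u a, u < t ∧ E.act u = some (q, a) ∧
      (∀ w, u < w → w < t → ∀ b, E.act w ≠ some (q, b)) ∧
      (E.conf (u + 1)).loc q = (E.conf t).loc q := by
  induction t with
  | zero => simp [E.init, Config.initial] at h
  | succ t ih =>
    by_cases ha : ∃ a, E.act t = some (q, a)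
    · obtain ⟨a, ha⟩ := ha
      exact ⟨t, a, by omega, ha, fun w h1 h2 => by omega, rfl⟩
    · push Not at ha
      have hl := E.loc_succ ha
      rw [hl] at h ⊢
      obtain ⟨u, a, h1, h2, h3, h4⟩ := ih h
      refine ⟨u, a, by omega, h2, fun w h5 h6 => ?_, h4⟩
      rcases Nat.lt_succ_iff_lt_or_eq.1 h6 with h6 | rfl
      · exact h3 w h5 h6
      · exact ha

theorem exists_invoke {t : ℕ} {q : P} {o : Op K} (h : ((E.conf t).loc q).op = some o) :
    ∃ i, i < t ∧ E.act i = some (q, .invoke o) ∧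
      ∀ j, i < j → j < t → ∀ o', E.act j ≠ some (q, .invoke o') := by
  induction t with
  | zero => simp [E.init, Config.initial, Local.op] at h
  | succ t ih =>
    have key : (∀ o', E.act t ≠ some (q, .invoke o')) → ((E.conf t).loc q).op = some o →
        ∃ i, i < t + 1 ∧ E.act i = some (q, .invoke o) ∧
          ∀ j, i < j → j < t + 1 → ∀ o', E.act j ≠ some (q, .invoke o') := by
      intro h1 h2
      obtain ⟨i, h3, h4, h5⟩ := ih h2
      refine ⟨i, by omega, h4, fun j h6 h7 => ?_⟩
      rcases Nat.lt_succ_iff_lt_or_eq.1 h7 with h7 | rfl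
      · exact h5 j h6 h7
      · exact h1
    by_cases ha : ∃ a, E.act t = some (q, a)
    · obtain ⟨a, ha⟩ := ha
      rcases (E.step t q a ha).op h with rfl | ⟨h1, h2⟩
      · exact ⟨t, by omega, ha, fun j h1 h2 => by omega⟩
      · refine key (fun o' h3 => ?_) h2
        rw [ha] at h3
        cases h3
        exact h1 o' rfl
    · push Not at ha
      rw [E.loc_succ ha] at h
      exact key (fun o' => ha _) h

theorem ended_mono {t t' : ℕ} (ht : t ≤ t') {q : P} (h : ((E.conf t).loc q).Ended)
    (hn : ∀ w, t ≤ w → w < t' → ∀ o, E.act w ≠ some (q, .invoke o)) :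
    ((E.conf t').loc q).Ended := by
  induction t', ht using Nat.le_induction with
  | base => exact h
  | succ t' ht ih =>
    have ih := ih fun w h1 h2 => hn w h1 (by omega)
    by_cases ha : ∃ a, E.act t' = some (q, a)
    · obtain ⟨a, ha⟩ := ha
      refine (E.step t' q a ha).ended ih ?_
      rintro o rfl
      exact hn t' ht (by omega) o ha
    · push Not at ha
      rwa [E.loc_succ ha]

variable {E}

theorem StepOf.not_idle {i s : ℕ} {q : P} {o : Op K} {a : Action K} (h : E.StepOf i q o s a) :
    (E.conf s).loc q ≠ .idle := by
  obtain ⟨-, h2, h3, h4⟩ := h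
  refine (E.step s q a h3).not_idle ?_
  rintro o' rfl
  exact h4 s h2 le_rfl o' h3

theorem StepOf.valid {i s : ℕ} {q : P} {o : Op K} {a : Action K} (h : E.StepOf i q o s a) :
    o.Valid :=
  (E.step i q _ h.1).invoke_inv.2

theorem StepOf.op {i s : ℕ} {q : P} {o : Op K} {a : Action K} (h : E.StepOf i q o s a) :
    ((E.conf s).loc q).op = some o := by
  have hi := h.not_idle
  obtain ⟨o', ho'⟩ : ∃ o', ((E.conf s).loc q).op = some o' := by
    cases hl : (E.conf s).loc q <;> simp_all [Local.op]
  obtain ⟨h1, h2, h3, h4⟩ := h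
  obtain ⟨i', h5, h6, h7⟩ := E.exists_invoke ho'
  rcases lt_trichotomy i i' with hlt | rfl | hlt
  · exact (h4 i' hlt h5.le o' h6).elim
  · rw [h1] at h6
    cases h6
    exact ho'
  · exact (h7 i hlt h2 o h1).elim

theorem StepOf.inv_unique {i i' s : ℕ} {q : P} {o o' : Op K} {a a' : Action K}
    (h : E.StepOf i q o s a) (h' : E.StepOf i' q o' s a') : i = i' := by
  rcases lt_trichotomy i i' with hlt | rfl | hlt
  · exact (h.2.2.2 i' hlt h'.2.1.le o' h'.1).elim
  · rfl
  · exact (h'.2.2.2 i hlt h.2.1.le o h.1).elim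

theorem exists_stepOf {s : ℕ} {q : P} {o : Op K} {a : Action K} (hs : E.act s = some (q, a))
    (h : ((E.conf s).loc q).op = some o) (ha : ∀ o', a ≠ .invoke o') :
    ∃ i, E.StepOf i q o s a := by
  obtain ⟨i, h1, h2, h3⟩ := E.exists_invoke h
  refine ⟨i, h2, h1, hs, fun j h4 h5 o' => ?_⟩
  rcases h5.lt_or_eq with h5 | rfl
  · exact h3 j h4 h5 o'
  · rw [hs]
    intro h6
    cases h6
    exact ha o' rfl

variable (E) in
/-- Step `s` is the one that determines the result of an operation. -/
def Decides (i : ℕ) (q : P) (o : Op K) (s : ℕ) (a : Action K) : Prop :=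
  E.StepOf i q o s a ∧ ¬ ((E.conf s).loc q).Ended ∧ ((E.conf (s + 1)).loc q).Ended

theorem Decides.unique {i s s' : ℕ} {q q' : P} {o o' : Op K} {a a' : Action K}
    (h : E.Decides i q o s a) (h' : E.Decides i q' o' s' a') :
    q = q' ∧ o = o' ∧ s = s' ∧ a = a' := by
  obtain ⟨h1, h2, h3⟩ := h
  obtain ⟨h1', h2', h3'⟩ := h'
  have e := h1.1.symm.trans h1'.1
  cases e
  have hs : s = s' := by
    rcases lt_trichotomy s s' with hlt | rfl | hlt
    · exact (h2' (E.ended_mono hlt h3 fun w h4 h5 o => h1'.2.2.2 w (by have := h1.2.1; omega)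
        h5.le o)).elim
    · rfl
    · exact (h2 (E.ended_mono hlt h3' fun w h4 h5 o => h1.2.2.2 w (by have := h1'.2.1; omega)
        h5.le o)).elim
  subst hs
  have e := h1.2.2.1.symm.trans h1'.2.2.1
  cases e
  exact ⟨rfl, rfl, rfl, rfl⟩

theorem StepOf.decides_scx {i s : ℕ} {q : P} {o : Op K} (h : E.StepOf i q o s .scxLinearize) :
    E.Decides i q o s .scxLinearize := by
  obtain ⟨o', S, lk, h1, -, h2⟩ := (E.step s q _ h.2.2.1).linearize_inv
  exact ⟨h, by simp [h1, Local.Ended], by simp [h2, Config.linearizeScx, Local.Ended]⟩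

theorem StepOf.decides_ret {i s : ℕ} {q : P} {o : Op K} {v : Resp}
    (h : E.StepOf i q o s (.ret v)) (hl : ¬ ((E.conf s).loc q).Ended) :
    E.Decides i q o s (.ret v) := by
  refine ⟨h, hl, ?_⟩
  rw [(E.step s q _ h.2.2.1).ret_idle]
  trivial

theorem LastBefore.unique {q : P} {a : Action K} {u u' e : ℕ} (h : E.LastBefore q a u e)
    (h' : E.LastBefore q a u' e) : u = u' := by
  rcases lt_trichotomy u u' with hlt | rfl | hlt
  · exact (h.2.2 u' hlt h'.1 h'.2.1).elim
  · rfl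
  · exact (h'.2.2 u hlt h.1 h.2.1).elim

theorem LastBefore.extend {q : P} {a b : Action K} {s u e : ℕ} (h : E.LastBefore q a s u)
    (hb : E.act u = some (q, b)) (hab : a ≠ b) (hue : u < e)
    (hu : ∀ w, u < w → w < e → ∀ b, E.act w ≠ some (q, b)) : E.LastBefore q a s e := by
  refine ⟨h.1.trans hue, h.2.1, fun w h1 h2 => ?_⟩
  rcases lt_trichotomy w u with hlt | rfl | hlt
  · exact h.2.2 w h1 hlt
  · rw [hb]
    intro h3
    cases h3
    exact hab rfl
  · exact hu w hlt h2 a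

variable (E) in
/-- The last Search of `q` before `e` began in step `s`, no operation was invoked by `q` since, and
at time `j`, `p` was in the data structure and pointed to `r`. -/
structure Searched (q : P) (p r : Addr) (s j e : ℕ) : Prop where
  last : E.LastBefore q .searchBegin s e
  le : s ≤ j
  lt : j < e
  noInvoke : ∀ w, s ≤ w → w < e → ∀ o, E.act w ≠ some (q, .invoke o)
  inDS : (E.conf j).InDS p
  pointsTo : (E.conf j).PointsTo p r

theorem Searched.extend {q : P} {p r : Addr} {s j u e : ℕ} {b : Action K}
    (h : E.Searched q p r s j u) (hb : E.act u = some (q, b)) (hb₁ : b ≠ .searchBegin)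
    (hb₂ : ∀ o, b ≠ .invoke o) (hue : u < e)
    (hu : ∀ w, u < w → w < e → ∀ b, E.act w ≠ some (q, b)) : E.Searched q p r s j e := by
  refine ⟨h.last.extend hb hb₁.symm hue hu, h.le, h.lt.trans hue, fun w h1 h2 o => ?_, h.inDS,
    h.pointsTo⟩
  rcases lt_trichotomy w u with hlt | rfl | hlt
  · exact h.noInvoke w h1 hlt o
  · rw [hb]
    intro h3
    cases h3
    exact hb₂ o rfl
  · exact hu w hlt h2 _

theorem Searched.inv_lt {q : P} {p r : Addr} {s j e : ℕ} (h : E.Searched q p r s j e) {i : ℕ}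
    {o : Op K} {a : Action K} (hi : E.StepOf i q o e a) : i < s := by
  by_contra hle
  exact h.noInvoke i (not_lt.1 hle) hi.2.1 o hi.1

/-- The nodes reached by a Search were adjacent in the data structure at some time during the
Search. -/
theorem exists_searched {t : ℕ} {q : P} {o : Op K} {p r : Addr}
    (h : (E.conf t).loc q = .search o p r) : ∃ s j, E.Searched q p r s j t := by
  induction t using Nat.strong_induction_on generalizing p r with
  | _ t ih =>
    obtain ⟨u, a, h1, h2, h3, h4⟩ := E.exists_last (t := t) (q := q) (by simp [h])
    rcases (E.step u q a h2).to_search (h4.trans h) with ⟨rfl, rfl, h5⟩ | ⟨rfl, p', h5, h6⟩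
    · refine ⟨u, u, ⟨h1, h2, fun w h6 h7 => h3 w h6 h7 _⟩, le_rfl, h1, fun w h6 h7 o => ?_,
        .refl, h5⟩
      rcases h6.eq_or_lt with rfl | h6
      · simp [h2]
      · exact h3 w h6 h7 _
    · obtain ⟨s, j, hs⟩ := ih u h1 h5
      have h7 : (E.conf j).InDS p := hs.inDS.tail hs.pointsTo
      obtain ⟨j', h8, h9, h10, h11⟩ := E.exists_inDS hs.lt.le h7
      have hs' := hs.extend h2 (by simp) (by simp) h1 h3
      refine ⟨s, j', hs'.last, hs.le.trans h8, by omega, hs'.noInvoke, h10, ?_⟩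
      rw [Config.PointsTo, h11]
      exact h6

theorem exists_searched_found {e : ℕ} {q : P} {o : Op K} {p r : Addr}
    (h : (E.conf e).loc q = .found o p r) :
    ∃ s₀ j s₁, E.Searched q p r s₀ j e ∧ E.LastBefore q .searchReturn s₁ e ∧ j ≤ s₁ := by
  obtain ⟨u, a, h1, h2, h3, h4⟩ := E.exists_last (t := e) (q := q) (by simp [h])
  obtain ⟨rfl, h5⟩ := (E.step u q a h2).to_found (h4.trans h)
  obtain ⟨s, j, hs⟩ := exists_searched h5
  exact ⟨s, j, u, hs.extend h2 (by simp) (by simp) h1 h3,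
    ⟨h1, h2, fun w h6 h7 => h3 w h6 h7 _⟩, hs.lt.le⟩

theorem exists_searched_delPR {e : ℕ} {q : P} {k : K} {c : ℕ} {p r : Addr} {lp lr : LlxResult}
    (h : (E.conf e).loc q = .delPR k c p r lp lr) :
    ∃ s₀ j s₁ u, E.Searched q p r s₀ j e ∧ E.LastBefore q .searchReturn s₁ e ∧ j ≤ s₁ ∧
      E.LastBefore q (.llx r) u e ∧ j ≤ u ∧ (E.conf u).LlxReturns r lr := by
  obtain ⟨u, a, h1, h2, h3, h4⟩ := E.exists_last (t := e) (q := q) (by simp [h])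
  obtain ⟨rfl, h5, h6⟩ := (E.step u q a h2).to_delPR (h4.trans h)
  obtain ⟨u', a', h1', h2', h3', h4'⟩ := E.exists_last (t := u) (q := q) (by simp [h5])
  obtain ⟨rfl, h5'⟩ := (E.step u' q a' h2').to_delP (h4'.trans h5)
  obtain ⟨s, j, s₁, hs, hs₁, hj⟩ := exists_searched_found h5'
  exact ⟨s, j, s₁, u,
    (hs.extend h2' (by simp) (by simp) h1' h3').extend h2 (by simp) (by simp) h1 h3,
    (hs₁.extend h2' (by simp) h1' h3').extend h2 (by simp) h1 h3, hj,
    ⟨h1, h2, fun w h6 h7 => h3 w h6 h7 _⟩, (hs.lt.trans h1').le, h6⟩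

end Execution

/-! ### Linearization points -/

theorem exists_isGreatest {S : Set ℕ} {b j : ℕ} (hj : j ∈ S) (hb : ∀ t ∈ S, t ≤ b) :
    ∃ m, IsGreatest S m :=
  have hbdd : BddAbove S := ⟨b, hb⟩
  ⟨sSup S, Nat.sSup_mem ⟨j, hj⟩ hbdd, fun _ ht => le_csSup hbdd ht⟩

theorem eq_filter_append_filter {α : Type*} {f : α → ℕ} (n : ℕ) {l : List α}
    (hl : l.Pairwise fun x y => f x ≤ f y) :
    l = (l.filter fun x => f x ≤ n) ++ l.filter fun x => ¬ f x ≤ n := by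
  induction l with
  | nil => rfl
  | cons a l ih =>
    obtain ⟨h1, h2⟩ := List.pairwise_cons.1 hl
    by_cases ha : f a ≤ n
    · rw [List.filter_cons_of_pos (by simpa using ha), List.filter_cons_of_neg (by simpa using ha),
        List.cons_append, ← ih h2]
    · have h3 : (l.filter fun x => f x ≤ n) = [] := by
        rw [List.filter_eq_nil_iff]
        intro x hx
        have := h1 x hx
        simp
        omega
      have h4 := ih h2
      rw [h3, List.nil_append] at h4
      rw [List.filter_cons_of_neg (by simpa using ha), List.filter_cons_of_pos (by simpa using ha),
        h3, List.nil_append, ← h4]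

namespace Config

variable {P K : Type*} [LinearOrder K] {C : Config P K}

theorem Inv.occurs_zero (I : C.Inv) {k : K} {p r : Addr} (hp : C.InDS p)
    (hpr : C.PointsTo p r) {x y : EKey K} (hx : C.HasKey p x) (hxk : x < ekey k)
    (hy : C.HasKey r y) (hky : ekey k < y) : C.Occurs k 0 := by
  refine .inr ⟨?_, rfl⟩
  rintro ⟨b, hb, nb, hnb, hkb⟩
  obtain ⟨l, hl⟩ := I.exists_seg
  have hpw := hl.pairwise I.increasing
  rw [hl.inDS_iff] at hp hb
  obtain ⟨np, hnp, rfl⟩ := hx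
  obtain ⟨nr, hnr, rfl⟩ := hy
  obtain ⟨np', hnp', hnext⟩ := hpr
  rw [hnp] at hnp'
  cases hnp'
  obtain ⟨l₁, l₂, rfl⟩ := List.append_of_mem hp
  obtain ⟨z, -, -, np', hnp', hl₂⟩ := Seg.append.1 hl
  rw [hnp] at hnp'
  cases hnp'
  rw [hnext] at hl₂
  have key : ∀ c d nc nd, KeyLt C.heap c d → C.heap c = some nc → C.heap d = some nd →
      nc.key < nd.key := by
    rintro c d nc nd ⟨nc', nd', h1, h2, h3⟩ h4 h5
    rw [h1] at h4
    rw [h2] at h5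
    cases h4
    cases h5
    exact h3
  cases l₂ with
  | nil => simp [Seg] at hl₂
  | cons r' l₂ =>
    obtain ⟨hr', -⟩ := hl₂
    cases hr'
    rw [List.pairwise_append, List.pairwise_cons, List.pairwise_cons] at hpw
    obtain ⟨-, ⟨-, h2, -⟩, h1⟩ := hpw
    simp only [List.mem_append, List.mem_cons] at hb
    rcases hb with hb | rfl | rfl | hb
    · have := key _ _ _ _ (h1 b hb p (by simp)) hnb hnp
      rw [hkb] at this
      exact lt_asymm this hxk
    · rw [hnp] at hnb
      cases hnb
      rw [hkb] at hxk
      exact lt_irrefl _ hxk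
    · rw [hnr] at hnb
      cases hnb
      rw [hkb] at hky
      exact lt_irrefl _ hky
    · have := key _ _ _ _ (h2 b hb) hnr hnb
      rw [hkb] at this
      exact lt_asymm this hky

theorem isKeyMultiset_initial (P K : Type*) [LinearOrder K] :
    (Config.initial P K).IsKeyMultiset 0 := by
  have hl : Seg (Config.initial P K).heap (some head) [head, tail] none :=
    ⟨rfl, _, rfl, rfl, _, rfl, rfl⟩
  rw [isKeyMultiset_iff (Inv.initial P K).increasing hl]
  intro k
  simp [total, occ, Config.initial, head, tail]

end Config

namespace Execution

variable {P K : Type*} [DecidableEq P] [LinearOrder K] {E : Execution P K}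

/-- No operation has two linearization points. -/
theorem Linearized.unique {x y : LinOp K} (hx : E.Linearized x) (hy : E.Linearized y)
    (h : x.inv = y.inv) : x = y := by
  have found : ∀ {i e q k p r v}, E.StepOf i q (.get k) e (.ret v) →
      (E.conf e).loc q = .found (.get k) p r → E.Decides i q (.get k) e (.ret v) :=
    fun h1 h2 => h1.decides_ret (by simp [h2, Local.Ended])
  have del : ∀ {i e q k c p r lp lr v}, E.StepOf i q (.delete k c) e (.ret v) →
      (E.conf e).loc q = .delPR k c p r lp lr → E.Decides i q (.delete k c) e (.ret v) :=
    fun h1 h2 => h1.decides_ret (by simp [h2, Local.Ended])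
  cases hx with
  | effective h1 =>
    have d := h1.decides_scx
    cases hy with
    | effective h1' =>
      cases h
      obtain ⟨-, rfl, rfl, -⟩ := d.unique h1'.decides_scx
      rfl
    | getAbsent h1' h2' => cases h; cases (d.unique (found h1' h2')).2.2.2
    | getPresent h1' h2' => cases h; cases (d.unique (found h1' h2')).2.2.2
    | deleteAbsent h1' h2' => cases h; cases (d.unique (del h1' h2')).2.2.2
    | deletePresent h1' h2' => cases h; cases (d.unique (del h1' h2')).2.2.2
  | getAbsent h1 h2 h3 h4 h5 h6 h7 =>
    have d := found h1 h2
    cases hy with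
    | effective h1' => cases h; cases (d.unique h1'.decides_scx).2.2.2
    | getAbsent h1' h2' h3' h4' h5' h6' h7' =>
      cases h
      obtain ⟨rfl, ho, rfl, -⟩ := d.unique (found h1' h2')
      cases ho
      rw [h2] at h2'
      cases h2'
      cases h5.unique h5'
      cases h6.unique h6'
      cases h7.unique h7'
      rfl
    | getPresent h1' h2' h3' =>
      cases h
      obtain ⟨rfl, ho, rfl, -⟩ := d.unique (found h1' h2')
      cases ho
      rw [h2] at h2'
      cases h2'
      exact (h4 (h3.unique h3')).elim
    | deleteAbsent h1' h2' => cases h; cases (d.unique (del h1' h2')).2.1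
    | deletePresent h1' h2' => cases h; cases (d.unique (del h1' h2')).2.1
  | getPresent h1 h2 h3 h4 h5 =>
    have d := found h1 h2
    cases hy with
    | effective h1' => cases h; cases (d.unique h1'.decides_scx).2.2.2
    | getAbsent h1' h2' h3' h4' =>
      cases h
      obtain ⟨rfl, ho, rfl, -⟩ := d.unique (found h1' h2')
      cases ho
      rw [h2] at h2'
      cases h2'
      exact (h4' (h3'.unique h3)).elim
    | getPresent h1' h2' h3' h4' h5' =>
      cases h
      obtain ⟨rfl, ho, rfl, ha⟩ := d.unique (found h1' h2')
      cases ho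
      cases ha
      rw [h2] at h2'
      cases h2'
      cases h4.unique h4'
      cases h5.unique h5'
      rfl
    | deleteAbsent h1' h2' => cases h; cases (d.unique (del h1' h2')).2.1
    | deletePresent h1' h2' => cases h; cases (d.unique (del h1' h2')).2.1
  | deleteAbsent h1 h2 h3 h4 h5 h6 h7 =>
    have d := del h1 h2
    cases hy with
    | effective h1' => cases h; cases (d.unique h1'.decides_scx).2.2.2
    | getAbsent h1' h2' => cases h; cases (d.unique (found h1' h2')).2.1
    | getPresent h1' h2' => cases h; cases (d.unique (found h1' h2')).2.1
    | deleteAbsent h1' h2' h3' h4' h5' h6' h7' =>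
      cases h
      obtain ⟨rfl, ho, rfl, -⟩ := d.unique (del h1' h2')
      cases ho
      rw [h2] at h2'
      cases h2'
      cases h5.unique h5'
      cases h6.unique h6'
      cases h7.unique h7'
      rfl
    | deletePresent h1' h2' h3' =>
      cases h
      obtain ⟨rfl, ho, rfl, -⟩ := d.unique (del h1' h2')
      cases ho
      rw [h2] at h2'
      cases h2'
      exact (h4 (h3.unique h3')).elim
  | deletePresent h1 h2 h3 h4 h5 h6 h7 =>
    have d := del h1 h2
    cases hy with
    | effective h1' => cases h; cases (d.unique h1'.decides_scx).2.2.2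
    | getAbsent h1' h2' => cases h; cases (d.unique (found h1' h2')).2.1
    | getPresent h1' h2' => cases h; cases (d.unique (found h1' h2')).2.1
    | deleteAbsent h1' h2' h3' h4' =>
      cases h
      obtain ⟨rfl, ho, rfl, -⟩ := d.unique (del h1' h2')
      cases ho
      rw [h2] at h2'
      cases h2'
      exact (h4' (h3'.unique h3)).elim
    | deletePresent h1' h2' h3' h4' h5' h6' h7' =>
      cases h
      obtain ⟨rfl, ho, rfl, -⟩ := d.unique (del h1' h2')
      cases ho
      rw [h2] at h2'
      cases h2'
      cases h5.unique h5'
      cases h6.unique h6'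
      cases h7.unique h7'
      rfl

theorem Linearized.inv_lt {x : LinOp K} (hx : E.Linearized x) : 2 * x.inv < x.pt := by
  have found : ∀ {i e q k p r v s j}, E.StepOf i q (.get k) e (.ret v) →
      (E.conf e).loc q = .found (.get k) p r → E.LastBefore q .searchBegin s e → s ≤ j →
      2 * i < 2 * j := by
    intro i e q k p r v s j h1 h2 h3 h4
    obtain ⟨s', j', s₁, hs, -, -⟩ := exists_searched_found h2
    have := hs.inv_lt h1
    have := h3.unique hs.last
    omega
  have del : ∀ {i e q k c p r lp lr v s j}, E.StepOf i q (.delete k c) e (.ret v) →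
      (E.conf e).loc q = .delPR k c p r lp lr → E.LastBefore q .searchBegin s e → s ≤ j →
      2 * i < 2 * j := by
    intro i e q k c p r lp lr v s j h1 h2 h3 h4
    obtain ⟨s', j', s₁, u, hs, -⟩ := exists_searched_delPR h2
    have := hs.inv_lt h1
    have := h3.unique hs.last
    omega
  cases hx with
  | effective h1 =>
    have := h1.2.1
    simp only
    omega
  | getAbsent h1 h2 h3 h4 h5 h6 h7 => exact found h1 h2 h5 h7.1.1
  | getPresent h1 h2 h3 h4 h5 => exact found h1 h2 h4 h5.1.1
  | deleteAbsent h1 h2 h3 h4 h5 h6 h7 => exact del h1 h2 h5 h7.1.1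
  | deletePresent h1 h2 h3 h4 h5 h6 h7 => exact del h1 h2 h5 h7.1.1

/-- Every operation that returns has a linearization point. -/
theorem exists_linearized {i : ℕ} {q : P} {o : Op K} {e : ℕ} {v : Resp}
    (h : E.StepOf i q o e (.ret v)) : ∃ pt, E.Linearized ⟨i, o, pt⟩ ∧ pt ≤ 2 * e := by
  have ho := h.op
  rcases (E.step e q _ h.2.2.1).ret_inv with ⟨k, p, r, n, h1, rfl, h2, h3⟩ |
    ⟨k, p, r, x, n, h1, rfl, h2, h3⟩ | ⟨k, c, p, r, x, lp, mr, n, h1, rfl, h2, h3⟩ | ⟨o', h1⟩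
  · rw [h1] at ho
    cases ho
    obtain ⟨s₀, j, s₁, hs, -, -⟩ := exists_searched_found h1
    obtain ⟨j', h4, h5, h6, h7⟩ := E.exists_inDS hs.lt.le (hs.inDS.tail hs.pointsTo)
    have h8 : (E.conf j').HasCount r n := by
      rw [Config.HasCount, h7]
      exact h3
    obtain ⟨m, hm⟩ := exists_isGreatest
      (S := {t | s₀ ≤ t ∧ t ≤ e ∧ (E.conf t).InDS r ∧ (E.conf t).HasCount r n})
      ⟨hs.le.trans h4, h5, h6, h8⟩ fun t ht => ht.2.1
    exact ⟨2 * m, .getPresent h h1 h2 hs.last hm, Nat.mul_le_mul_left 2 hm.1.2.1⟩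
  · rw [h1] at ho
    cases ho
    obtain ⟨s₀, j, s₁, hs, hs₁, hj⟩ := exists_searched_found h1
    obtain ⟨m, hm⟩ := exists_isGreatest
      (S := {t | s₀ ≤ t ∧ t ≤ s₁ ∧ (E.conf t).InDS p ∧ (E.conf t).PointsTo p r})
      ⟨hs.le, hj, hs.inDS, hs.pointsTo⟩ fun t ht => ht.2.1
    exact ⟨2 * m, .getAbsent h h1 h2 h3 hs.last hs₁ hm,
      Nat.mul_le_mul_left 2 (hm.1.2.1.trans hs₁.1.le)⟩
  · rw [h1] at ho
    cases ho
    obtain ⟨s₀, j, s₁, u, hs, hs₁, hj, hu, hju, h4⟩ := exists_searched_delPR h1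
    by_cases hx : x = ekey k
    · subst hx
      obtain ⟨j', h5, h6, h7, h8⟩ := E.exists_inDS hju (hs.inDS.tail hs.pointsTo)
      have h9 : (E.conf j').HasCount r mr := by
        obtain ⟨-, nd, h10, h11, -⟩ := h4
        exact ⟨nd, h8.trans h10, h11⟩
      obtain ⟨m, hm⟩ := exists_isGreatest
        (S := {t | s₀ ≤ t ∧ t ≤ u ∧ (E.conf t).InDS r ∧ (E.conf t).HasCount r mr})
        ⟨hs.le.trans h5, h6, h7, h9⟩ fun t ht => ht.2.1
      exact ⟨2 * m, .deletePresent h h1 h2 (h3.resolve_left (by simp)) hs.last hu hm,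
        Nat.mul_le_mul_left 2 (hm.1.2.1.trans hu.1.le)⟩
    · obtain ⟨m, hm⟩ := exists_isGreatest
        (S := {t | s₀ ≤ t ∧ t ≤ s₁ ∧ (E.conf t).InDS p ∧ (E.conf t).PointsTo p r})
        ⟨hs.le, hj, hs.inDS, hs.pointsTo⟩ fun t ht => ht.2.1
      exact ⟨2 * m, .deleteAbsent h h1 h2 hx hs.last hs₁ hm,
        Nat.mul_le_mul_left 2 (hm.1.2.1.trans hs₁.1.le)⟩
  · rw [h1] at ho
    cases ho
    obtain ⟨u, a, h2, h3, h4, h5⟩ := E.exists_last (t := e) (q := q) (by simp [h1])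
    obtain rfl := (E.step u q a h3).to_scxDone (h5.trans h1)
    obtain ⟨o', S, lk, h6, -, h7⟩ := (E.step u q _ h3).linearize_inv
    have ho' : o' = o := by
      have := h5.trans h1
      simpa [h7, Config.linearizeScx] using this
    subst ho'
    obtain ⟨i', hi'⟩ := exists_stepOf (o := o') h3 (by simp [h6, Local.op]) (by simp)
    have : i' = i := by
      rcases lt_trichotomy i' i with hlt | rfl | hlt
      · have hiu : u < i := by
          by_contra hle
          exact hi'.2.2.2 i hlt (not_lt.1 hle) _ h.1
        exact (h4 i hiu h.2.1 _ h.1).elim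
      · rfl
      · exact (h.2.2.2 i' hlt (hi'.2.1.trans h2).le _ hi'.1).elim
    subst this
    exact ⟨2 * u + 1, .effective hi', by omega⟩

theorem hasKey_of_inDS {j e : ℕ} (hje : j ≤ e) {r : Addr} {x : EKey K}
    (hr : (E.conf j).Seen r) (hx : (E.conf e).HasKey r x) : (E.conf j).HasKey r x := by
  obtain ⟨nd, hnd⟩ := Option.ne_none_iff_exists'.1 ((E.inv j).alloc_of_seen hr)
  have h : (E.conf j).HasKey r nd.key := ⟨nd, hnd, rfl⟩
  rwa [hx.unique (E.hasKey_mono hje h)]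

/-- If Search returned nodes `p` and `r` such that the key of `r` is not the one searched for, then
this key was absent whenever `p` was in the data structure and pointed to `r`. -/
theorem occurs_zero_of_foundAt {j e : ℕ} (hje : j ≤ e) {k : K} {p r : Addr} {x : EKey K}
    (h : (E.conf e).FoundAt k p r) (hx : (E.conf e).HasKey r x) (hxk : x ≠ ekey k)
    (hp : (E.conf j).InDS p) (hpr : (E.conf j).PointsTo p r) : (E.conf j).Occurs k 0 := by
  obtain ⟨np, h1, h2⟩ := h.left_lt
  obtain ⟨nr, h3, h4⟩ := h.le_right
  have hxr : x = nr.key := hx.unique ⟨nr, h3, rfl⟩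
  exact (E.inv j).occurs_zero hp hpr (hasKey_of_inDS hje (.inl hp) ⟨np, h1, rfl⟩) h2
    (hasKey_of_inDS hje (.inl (hp.tail hpr)) hx)
    (lt_of_le_of_ne (by rw [hxr]; exact h4) hxk.symm)

theorem exec_delete_eq_self {C : Config P K} {σ : Multiset K} (hσ : C.IsKeyMultiset σ) {k : K}
    {n c : ℕ} (h : C.Occurs k n) (hc : n < c) : (Op.delete k c).exec σ = σ := by
  have := (hσ k n).1 h
  rw [Op.exec, if_neg (by omega)]

/-- An operation that is not linearized at an SCX does not change the multiset. -/
theorem Linearized.exec_eq_self {x : LinOp K} (hx : E.Linearized x) {j : ℕ}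
    (hj : x.pt = 2 * j) {σ : Multiset K} (hσ : (E.conf j).IsKeyMultiset σ) :
    x.op.exec σ = σ := by
  cases hx with
  | effective => simp only at hj; omega
  | getAbsent => rfl
  | getPresent => rfl
  | @deleteAbsent _ q _ _ _ _ _ _ _ e _ s₁ j' h1 h2 h3 h4 h5 h6 h7 =>
    obtain rfl : j' = j := by simpa using hj
    have hloc := (E.inv e).loc q
    rw [h2] at hloc
    obtain ⟨-, h8, h9, h10⟩ := h7.1
    exact exec_delete_eq_self hσ
      (occurs_zero_of_foundAt (h8.trans h6.1.le) hloc.1 h3 h4 h9 h10) h1.valid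
  | @deletePresent _ _ _ _ _ r _ _ _ e _ u j' h1 h2 h3 h4 h5 h6 h7 =>
    obtain rfl : j' = j := by simpa using hj
    obtain ⟨-, h8, h9, h10⟩ := h7.1
    exact exec_delete_eq_self hσ
      (.inl ⟨r, h9, hasKey_of_inDS (h8.trans h6.1.le) (.inl h9) h3, h10⟩) h4

theorem Linearized.stepOf {x : LinOp K} (hx : E.Linearized x) {s : ℕ} (hs : x.pt = 2 * s + 1) :
    ∃ q, E.StepOf x.inv q x.op s .scxLinearize := by
  cases hx with
  | @effective _ q _ s' h =>
    obtain rfl : s' = s := by simpa using hs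
    exact ⟨q, h⟩
  | getAbsent => simp only at hs; omega
  | getPresent => simp only at hs; omega
  | deleteAbsent => simp only at hs; omega
  | deletePresent => simp only at hs; omega

theorem foldl_exec_eq_self {σ : Multiset K} {l : List (Op K)} (h : ∀ o ∈ l, o.exec σ = σ) :
    l.foldl Op.exec σ = σ := by
  induction l with
  | nil => rfl
  | cons o l ih =>
    rw [List.foldl_cons, h o (by simp)]
    exact ih fun b hb => h b (by simp [hb])

/-- The operations linearized in step `s` have the same effect as the step. -/
theorem isKeyMultiset_succ {s : ℕ} {σ : Multiset K} (hσ : (E.conf s).IsKeyMultiset σ)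
    {l : List (LinOp K)} (hnd : l.Nodup)
    (hl : ∀ x, x ∈ l ↔ E.Linearized x ∧ x.pt = 2 * s + 1) :
    (E.conf (s + 1)).IsKeyMultiset ((l.map LinOp.op).foldl Op.exec σ) := by
  by_cases hs : ∃ q, E.act s = some (q, .scxLinearize)
  · obtain ⟨q, hq⟩ := hs
    obtain ⟨o, S, lk, h1, h2, h3⟩ := (E.step s q _ hq).linearize_inv
    obtain ⟨i, hi⟩ := exists_stepOf (o := o) hq (by simp [h1, Local.op]) (by simp)
    have hl' : l = [⟨i, o, 2 * s + 1⟩] := by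
      refine List.perm_singleton.1 ((List.perm_ext_iff_of_nodup hnd (by simp)).2 fun x => ?_)
      rw [hl, List.mem_singleton]
      constructor
      · rintro ⟨hx, hpt⟩
        obtain ⟨q', h4⟩ := hx.stepOf hpt
        obtain rfl : q' = q := by
          have := h4.2.2.1.symm.trans hq
          simpa using this
        exact hx.unique (.effective hi) (h4.inv_unique hi)
      · rintro rfl
        exact ⟨.effective hi, rfl⟩
    rw [hl', h3]
    exact (E.inv s).isKeyMultiset_linearizeScx h1 h2 hσ
  · have hl' : l = [] := by
      refine List.eq_nil_iff_forall_not_mem.2 fun x hx => ?_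
      obtain ⟨h1, h2⟩ := (hl x).1 hx
      obtain ⟨q, h3⟩ := h1.stepOf h2
      exact hs ⟨q, h3.2.2.1⟩
    rw [hl']
    cases ha : E.act s with
    | none => rwa [E.idle s ha]
    | some y =>
      refine (E.step s y.1 y.2 ha).isKeyMultiset (E.inv s) (fun h => hs ⟨y.1, ?_⟩) hσ
      rw [ha, ← h]

/-- The multiset of keys after the operations with linearization points up to `n`. -/
theorem isKeyMultiset_of_pt_le (n : ℕ) (l : List (LinOp K)) (hnd : l.Nodup)
    (hl : ∀ x, x ∈ l ↔ E.Linearized x ∧ x.pt ≤ n) (hs : l.Pairwise fun x y => x.pt ≤ y.pt) :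
    (E.conf ((n + 1) / 2)).IsKeyMultiset (atomicExec (l.map LinOp.op)) := by
  induction n generalizing l with
  | zero =>
    have hl' : l = [] := by
      refine List.eq_nil_iff_forall_not_mem.2 fun x hx => ?_
      obtain ⟨h1, h2⟩ := (hl x).1 hx
      have := h1.inv_lt
      omega
    rw [hl']
    change (E.conf 0).IsKeyMultiset 0
    rw [E.init]
    exact Config.isKeyMultiset_initial P K
  | succ n ih =>
    have h1 := ih (l.filter fun x => x.pt ≤ n) (hnd.filter _)
      (fun x => by
        simp only [List.mem_filter, hl, decide_eq_true_eq]
        constructor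
        · exact fun h => ⟨h.1.1, h.2⟩
        · exact fun h => ⟨⟨h.1, by omega⟩, h.2⟩)
      (hs.filter _)
    rw [eq_filter_append_filter n hs, List.map_append, atomicExec, List.foldl_append]
    have h2 : ∀ x, x ∈ (l.filter fun x => ¬ x.pt ≤ n) ↔ E.Linearized x ∧ x.pt = n + 1 := by
      intro x
      simp only [List.mem_filter, hl, decide_eq_true_eq]
      constructor
      · exact fun h => ⟨h.1.1, by omega⟩
      · exact fun h => ⟨⟨h.1, by omega⟩, by omega⟩
    rcases Nat.even_or_odd' (n + 1) with ⟨j, hj | hj⟩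
    · have e1 : (n + 1) / 2 = j := by omega
      have e2 : (n + 1 + 1) / 2 = j := by omega
      rw [e1] at h1
      rw [e2, foldl_exec_eq_self]
      · exact h1
      · intro o ho
        obtain ⟨x, hx, rfl⟩ := List.mem_map.1 ho
        obtain ⟨h3, h4⟩ := (h2 x).1 hx
        exact h3.exec_eq_self (h4.trans hj) h1
    · have e1 : (n + 1) / 2 = j := by omega
      have e2 : (n + 1 + 1) / 2 = j + 1 := by omega
      rw [e1] at h1
      rw [e2]
      exact isKeyMultiset_succ h1 (hnd.filter _) (by simpa only [hj] using h2)

/-- At every time, only finitely many operations have been linearized. -/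
theorem exists_isLinSeq (E : Execution P K) (t : ℕ) : ∃ l, E.IsLinSeq t l := by
  have hfin : {x | E.Linearized x ∧ x.pt ≤ 2 * t}.Finite := by
    refine Set.Finite.of_finite_image (f := LinOp.inv) ((Set.finite_lt_nat (t + 1)).subset ?_) ?_
    · rintro _ ⟨x, ⟨h1, h2⟩, rfl⟩
      have := h1.inv_lt
      simp only [Set.mem_ofPred_eq]
      omega
    · exact fun x hx y hy h => hx.1.unique hy.1 h
  have hp := List.mergeSort_perm hfin.toFinset.toList fun x y => decide (x.pt ≤ y.pt)
  refine ⟨_, hp.nodup_iff.2 hfin.toFinset.nodup_toList, fun x => ?_, ?_⟩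
  · rw [hp.mem_iff]
    simp
  · have := List.pairwise_mergeSort (le := fun x y : LinOp K => decide (x.pt ≤ y.pt))
      (fun a b c h1 h2 => by simp at *; omega) (fun a b => by simp; omega) hfin.toFinset.toList
    simpa using this

end Execution

end LLXMultiset

theorem mainTheorem4 {P K : Type*} [DecidableEq P] [LinearOrder K]
    (E : LLXMultiset.Execution P K) :
    E.LinWellDefined ∧
      ∀ t : ℕ, (∃ l, E.IsLinSeq t l) ∧
        ∀ l, E.IsLinSeq t l →
          (E.conf t).IsKeyMultiset (LLXMultiset.atomicExec (l.map LLXMultiset.LinOp.op)) := by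
  refine ⟨⟨fun x y hx hy h => hx.unique hy h, fun i q o e v h => ?_⟩,
    fun t => ⟨E.exists_isLinSeq t, fun l hl => ?_⟩⟩
  · obtain ⟨pt, h1, h2⟩ := LLXMultiset.Execution.exists_linearized h
    exact ⟨pt, h1, h1.inv_lt, h2⟩
  · have h := LLXMultiset.Execution.isKeyMultiset_of_pt_le (2 * t) l hl.1 hl.2.1 hl.2.2
    have e : (2 * t + 1) / 2 = t := by omega
    rwa [e] at h
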